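/- A *Pervin space* is a pair $(X,\mathcal S)$ with $X$ a set and $\mathcal S$ a bounded sublattice of the powerset of $X$; a morphism $(X,\mathcal S)\to(Y,\mathcal T)$ is a function $f:X\to Y$ with $f^{-1}(T)\in\mathcal S$ for all $T\in\mathcal T$. Topological notions ($T_0$, sober, dense) refer to the topology $\Omega_{\mathcal S}(X)$ on $X$ generated by $\mathcal S$. A Pervin space is *symmetric* if $\mathcal S$ is closed under complements, and the *symmetrization* of $(X,\mathcal S)$ is $(X,\overline{\mathcal S})$, with $\overline{\mathcal S}$ the Boolean subalgebra of the powerset generated by $\mathcal S$. An *extremal monomorphism* is a monomorphism $m$ such that in every factorization $m=g\circ e$ with $e$ an epimorphism, $e$ is an isomorphism. A symmetric Pervin space is *complete* if every dense extremal monomorphism (of Pervin spaces) from it into a $T_0$ symmetric Pervin space is an isomorphism, and a Pervin space is *complete* if its symmetrization is. A *Frith frame* is a pair $(L,S)$ with $L$ a frame and $S$ a bounded sublattice of $L$ such that every element of $L$ is a join of elements of $S$; a morphism $(L,S)\to(M,T)$ is a frame homomorphism $h:L\to M$ with $h[S]\subseteq T$. It is *symmetric* if $S$ is a Boolean algebra.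 The *symmetric reflection* of $(L,S)$ is $(\mathcal C_SL,\overline S)$, where $\mathcal C_SL$ is the subframe of the frame of congruences of $L$ (ordered by inclusion) generated by the congruences $\nabla_a=\{(x,y)\mid a\vee x=a\vee y\}$, $a\in L$, and $\Delta_s=\{(x,y)\mid s\wedge x=s\wedge y\}$, $s\in S$, and $\overline S$ is the sublattice of $\mathcal C_SL$ generated by the $\nabla_s$, $s\in S$, and their complements $\Delta_s$. A symmetric Frith frame $(L,B)$ is *complete* if every morphism $h:(M,C)\to(L,B)$ with $(M,C)$ symmetric, $h$ dense (that is, $h(a)=0$ implies $a=0$) and $h[C]=B$ is an isomorphism, and a Frith frame is *complete* if its symmetric reflection is. There is a dual adjunction $\mathbf\Omega\dashv\mathbf{pt}$ between Pervin spaces and Frith frames: $\mathbf\Omega(X,\mathcal S)=(\Omega_{\mathcal S}(X),\mathcal S)$ and $\mathbf\Omega(f)=f^{-1}$, while $\mathbf{pt}(L,S)$ is the set $\mathrm{pt}(L)$ of frame homomorphisms $p:L\to\mathbf 2$ with the lattice of the sets $\widehat s=\{p\mid p(s)=1\}$, $s\in S$, and $\mathbf{pt}(h)(p)=p\circ h$.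 Its unit sends $x$ to the point $U\mapsto[x\in U]$ and its counit is given by $a\mapsto\widehat a$. **Theorem.** Assume the Prime Ideal Theorem: every proper ideal of a bounded distributive lattice is contained in a prime ideal. Then $\mathbf\Omega$ sends $T_0$ complete Pervin spaces to complete Frith frames, $\mathbf{pt}$ sends complete Frith frames to $T_0$ complete Pervin spaces, and the adjunction $\mathbf\Omega\dashv\mathbf{pt}$ so restricted is a dual equivalence between the full subcategory of $T_0$ complete Pervin spaces and the full subcategory of complete Frith frames: both restricted functors are (dual) equivalences, and the unit and the counit are isomorphisms. Moreover, every $T_0$ complete Pervin space is sober and every complete Frith frame is spatial, i.e. the underlying space, respectively the underlying frame, is a fixpoint of the classical dual adjunction between topological spaces and frames. -/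

import Mathlib

open CategoryTheory Opposite

universe u

/-! ### The Prime Ideal Theorem -/

/-- The Prime Ideal Theorem: every proper ideal of a bounded distributive lattice extends to a
prime ideal. -/
def PrimeIdealTheorem : Prop :=
  ∀ (D : Type u) [DistribLattice D] [BoundedOrder D] (I : Order.Ideal D), I.IsProper →
    ∃ J : Order.Ideal D, I ≤ J ∧ J.IsPrime

/-! ### Pervin spaces -/

/-- A Pervin space: a set with a bounded sublattice of its powerset. -/
structure Pervin where
  /-- The underlying set. -/
  carrier : Type u
  /-- The bounded sublattice of the powerset. -/
  sets : Set (Set carrier)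
  univ_mem : Set.univ ∈ sets
  empty_mem : ∅ ∈ sets
  inter_mem : ∀ {A B : Set carrier}, A ∈ sets → B ∈ sets → A ∩ B ∈ sets
  union_mem : ∀ {A B : Set carrier}, A ∈ sets → B ∈ sets → A ∪ B ∈ sets

namespace Pervin

instance : CoeSort Pervin.{u} (Type u) := ⟨Pervin.carrier⟩

/-- The topology generated by the lattice of a Pervin space. -/
instance (X : Pervin.{u}) : TopologicalSpace X := TopologicalSpace.generateFrom X.sets

/-- Morphisms of Pervin spaces. -/
@[ext]
structure Hom (X Y : Pervin.{u}) where
  /-- The underlying function. -/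
  toFun : X → Y
  preimage_mem : ∀ T ∈ Y.sets, toFun ⁻¹' T ∈ X.sets

instance : Category Pervin.{u} where
  Hom := Hom
  id X := ⟨id, fun _ hT => hT⟩
  comp f g := ⟨g.toFun ∘ f.toFun, fun T hT => f.preimage_mem _ (g.preimage_mem T hT)⟩

@[ext]
theorem hom_ext {X Y : Pervin.{u}} {f g : X ⟶ Y} (h : ∀ x, f.toFun x = g.toFun x) : f = g :=
  Hom.ext (funext h)

theorem id_toFun (X : Pervin.{u}) : Hom.toFun (𝟙 X) = id := rfl

theorem comp_toFun {X Y Z : Pervin.{u}} (f : X ⟶ Y) (g : Y ⟶ Z) :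
    (f ≫ g).toFun = g.toFun ∘ f.toFun := rfl

theorem Hom.continuous {X Y : Pervin.{u}} (f : X ⟶ Y) : Continuous f.toFun :=
  continuous_generateFrom_iff.2 fun T hT =>
    TopologicalSpace.isOpen_generateFrom_of_mem (f.preimage_mem T hT)

/-- A Pervin space is `T₀` when its underlying topological space is. -/
def IsT0 (X : Pervin.{u}) : Prop := T0Space X

/-- A Pervin space is sober when its underlying topological space is a fixpoint of the adjunction
between topological spaces and locales. -/
def IsSober (X : Pervin.{u}) : Prop :=
  IsIso (Locale.adjunctionTopToLocalePT.unit.app (TopCat.of X))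

/-- A Pervin space is symmetric when its lattice is a Boolean algebra. -/
def IsSymmetric (X : Pervin.{u}) : Prop := ∀ S ∈ X.sets, Sᶜ ∈ X.sets

/-- A morphism is dense when its image is dense for the topology of the codomain. -/
def IsDense {X Y : Pervin.{u}} (f : X ⟶ Y) : Prop := DenseRange f.toFun

/-- Extremal monomorphisms of Pervin spaces: monomorphisms that do not factor through a
non-invertible epimorphism. -/
def IsExtremalMono {X Y : Pervin.{u}} (f : X ⟶ Y) : Prop :=
  Mono f ∧ ∀ (Z : Pervin.{u}) (e : X ⟶ Z) (g : Z ⟶ Y), e ≫ g = f → Epi e → IsIso e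

/-- The symmetrization of `(X, S)`: the same set with the Boolean subalgebra generated by `S`. -/
def symmetrization (X : Pervin.{u}) : Pervin.{u} where
  carrier := X
  sets := BooleanSubalgebra.closure X.sets
  univ_mem := (BooleanSubalgebra.closure X.sets).top_mem
  empty_mem := (BooleanSubalgebra.closure X.sets).bot_mem
  inter_mem h₁ h₂ := (BooleanSubalgebra.closure X.sets).inf_mem h₁ h₂
  union_mem h₁ h₂ := (BooleanSubalgebra.closure X.sets).sup_mem h₁ h₂

/-- Completeness for a symmetric Pervin space. -/
def IsCompleteOfSymmetric (X : Pervin.{u}) : Prop :=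
  ∀ (Y : Pervin.{u}) (m : X ⟶ Y), Y.IsSymmetric → Y.IsT0 →
    IsDense m → IsExtremalMono m → IsIso m

/-- A Pervin space is complete when its symmetrization is. -/
def IsComplete (X : Pervin.{u}) : Prop := X.symmetrization.IsCompleteOfSymmetric

end Pervin

/-- The property of being a `T₀` complete Pervin space. -/
def T0Complete : ObjectProperty Pervin.{u} := fun X => X.IsT0 ∧ X.IsComplete

/-! ### Frith frames -/

/-- A Frith frame: a frame with a join-dense bounded sublattice. -/
structure FrithFrame where
  /-- The underlying frame. -/
  carrier : Type u
  [frame : Order.Frame carrier]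
  /-- The join-dense bounded sublattice. -/
  lat : Set carrier
  top_mem : ⊤ ∈ lat
  bot_mem : ⊥ ∈ lat
  inf_mem : ∀ {a b : carrier}, a ∈ lat → b ∈ lat → a ⊓ b ∈ lat
  sup_mem : ∀ {a b : carrier}, a ∈ lat → b ∈ lat → a ⊔ b ∈ lat
  join_dense : ∀ a : carrier, ∃ A ⊆ lat, sSup A = a

namespace FrithFrame

instance : CoeSort FrithFrame.{u} (Type u) := ⟨FrithFrame.carrier⟩

instance (L : FrithFrame.{u}) : Order.Frame L := L.frame

/-- Morphisms of Frith frames. -/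
@[ext]
structure Hom (L M : FrithFrame.{u}) where
  /-- The underlying frame homomorphism. -/
  toFrameHom : FrameHom L M
  map_mem : ∀ s ∈ L.lat, toFrameHom s ∈ M.lat

instance : Category FrithFrame.{u} where
  Hom := Hom
  id L := ⟨FrameHom.id L, fun _ hs => hs⟩
  comp f g := ⟨g.toFrameHom.comp f.toFrameHom, fun s hs => g.map_mem _ (f.map_mem s hs)⟩

@[ext]
theorem hom_ext {L M : FrithFrame.{u}} {f g : L ⟶ M}
    (h : ∀ a, f.toFrameHom a = g.toFrameHom a) : f = g :=
  Hom.ext (FrameHom.ext h)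

theorem id_toFrameHom (L : FrithFrame.{u}) : Hom.toFrameHom (𝟙 L) = FrameHom.id L := rfl

theorem comp_toFrameHom {L M N : FrithFrame.{u}} (f : L ⟶ M) (g : M ⟶ N) :
    (f ≫ g).toFrameHom = g.toFrameHom.comp f.toFrameHom := rfl

/-- A Frith frame is spatial when its underlying frame is a fixpoint of the adjunction between
topological spaces and locales. -/
def IsSpatial (L : FrithFrame.{u}) : Prop :=
  IsIso (Locale.adjunctionTopToLocalePT.counit.app (Locale.of L))

/-- A Frith frame is symmetric when its lattice is a Boolean algebra. -/
def IsSymmetric (L : FrithFrame.{u}) : Prop := ∀ s ∈ L.lat, ∃ t ∈ L.lat, IsCompl s t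

/-- A morphism of Frith frames is dense when only the bottom element is sent to bottom. -/
def IsDense {L M : FrithFrame.{u}} (h : L ⟶ M) : Prop := ∀ a, h.toFrameHom a = ⊥ → a = ⊥

/-- Extremal epimorphisms of Frith frames: the morphisms `h : (L, S) ⟶ (M, T)` with `h[S] = T`. -/
def IsExtremalEpi {L M : FrithFrame.{u}} (h : L ⟶ M) : Prop := h.toFrameHom '' L.lat = M.lat

end FrithFrame

/-! ### The frame of congruences -/

/-- A frame congruence: an equivalence relation compatible with finite meets and arbitrary
joins. -/
@[ext]
structure FrameCongruence (L : Type u) [Order.Frame L] where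
  /-- The underlying relation. -/
  rel : L → L → Prop
  refl' : ∀ x, rel x x
  symm' : ∀ {x y}, rel x y → rel y x
  trans' : ∀ {x y z}, rel x y → rel y z → rel x z
  inf' : ∀ {x y z w}, rel x y → rel z w → rel (x ⊓ z) (y ⊓ w)
  iSup' : ∀ {ι : Type u} {f g : ι → L}, (∀ i, rel (f i) (g i)) → rel (⨆ i, f i) (⨆ i, g i)

namespace FrameCongruence

variable {L : Type u} [Order.Frame L]

/-- Congruences are ordered by inclusion. -/
instance : PartialOrder (FrameCongruence L) where
  le θ φ := ∀ x y, θ.rel x y → φ.rel x y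
  le_refl _ _ _ h := h
  le_trans _ _ _ h₁ h₂ x y h := h₂ x y (h₁ x y h)
  le_antisymm θ φ h₁ h₂ := by
    ext x y
    exact ⟨h₁ x y, h₂ x y⟩

instance : InfSet (FrameCongruence L) where
  sInf A :=
    { rel := fun x y => ∀ θ ∈ A, θ.rel x y
      refl' := fun x θ _ => θ.refl' x
      symm' := fun h θ hθ => θ.symm' (h θ hθ)
      trans' := fun h₁ h₂ θ hθ => θ.trans' (h₁ θ hθ) (h₂ θ hθ)
      inf' := fun h₁ h₂ θ hθ => θ.inf' (h₁ θ hθ) (h₂ θ hθ)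
      iSup' := fun h θ hθ => θ.iSup' fun i => h i θ hθ }

instance : CompleteLattice (FrameCongruence L) :=
  completeLatticeOfInf _ fun _ =>
    ⟨fun θ hθ _ _ h => h θ hθ, fun _ hφ x y h _ hθ => hφ hθ x y h⟩

theorem rel_sSup_image (θ : FrameCongruence L) (x : L) : θ.rel (sSup {y | θ.rel y x}) x := by
  have h : θ.rel (⨆ y : {y // θ.rel y x}, y.1) (⨆ _ : {y // θ.rel y x}, x) :=
    θ.iSup' fun y => y.2
  have : Nonempty {y // θ.rel y x} := ⟨⟨x, θ.refl' x⟩⟩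
  rw [ciSup_const] at h
  rwa [sSup_eq_iSup']

/-- The nucleus that sends an element to the largest element congruent to it. -/
def toNucleus (θ : FrameCongruence L) : Nucleus L where
  toFun x := sSup {y | θ.rel y x}
  map_inf' x y := by
    have mono : ∀ {a b : L}, a ≤ b → sSup {y | θ.rel y a} ≤ sSup {y | θ.rel y b} := by
      intro a b hab
      refine sSup_le fun c (hc : θ.rel c a) => le_trans (le_sup_left (b := b)) (le_sSup ?_)
      have h := θ.iSup' (ι := ULift Bool) (f := fun i => cond i.down c b)
        (g := fun i => cond i.down a b) (by rintro ⟨_ | _⟩ <;> simp [hc, θ.refl'])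
      have e : ∀ a b : L, (⨆ i : ULift.{u} Bool, cond i.down a b) = a ⊔ b := fun a b => by
        rw [iSup_ulift, iSup_bool_eq]
        rfl
      rw [e, e, sup_eq_right.2 hab] at h
      exact h
    refine le_antisymm (le_inf (mono inf_le_left) (mono inf_le_right)) (le_sSup ?_)
    exact θ.inf' (θ.rel_sSup_image x) (θ.rel_sSup_image y)
  idempotent' x := le_sSup
    (θ.trans' (θ.rel_sSup_image (sSup {y | θ.rel y x})) (θ.rel_sSup_image x))
  le_apply' x := le_sSup (θ.refl' x)

theorem toNucleus_rel (θ : FrameCongruence L) (x : L) : θ.rel (θ.toNucleus x) x :=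
  θ.rel_sSup_image x

theorem le_toNucleus (θ : FrameCongruence L) {x y : L} (h : θ.rel y x) : y ≤ θ.toNucleus x :=
  le_sSup h

theorem rel_iff (θ : FrameCongruence L) (x y : L) :
    θ.rel x y ↔ θ.toNucleus x = θ.toNucleus y := by
  constructor
  · intro h
    exact le_antisymm (θ.le_toNucleus (θ.trans' (θ.toNucleus_rel x) h))
      (θ.le_toNucleus (θ.trans' (θ.toNucleus_rel y) (θ.symm' h)))
  · intro h
    exact θ.trans' (θ.symm' (θ.toNucleus_rel x)) (h ▸ θ.toNucleus_rel y)

/-- The congruence of a nucleus. -/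
def ofNucleus (n : Nucleus L) : FrameCongruence L where
  rel x y := n x = n y
  refl' _ := rfl
  symm' h := h.symm
  trans' h₁ h₂ := h₁.trans h₂
  inf' h₁ h₂ := by rw [n.map_inf, n.map_inf, h₁, h₂]
  iSup' {ι f g} h := by
    have key : ∀ f g : ι → L, (∀ i, n (f i) = n (g i)) → n (⨆ i, f i) ≤ n (⨆ i, g i) := by
      intro f g h
      rw [← n.idempotent (⨆ i, g i)]
      refine n.monotone (iSup_le fun i => ?_)
      exact n.le_apply.trans ((h i).le.trans (n.monotone (le_iSup g i)))
    exact le_antisymm (key f g h) (key g f fun i => (h i).symm)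

/-- Frame congruences and nuclei are in bijection. -/
def nucleusIso : FrameCongruence L ≃o Nucleus L where
  toFun := toNucleus
  invFun := ofNucleus
  left_inv θ := by
    ext x y
    exact (θ.rel_iff x y).symm
  right_inv n := by
    ext x
    refine le_antisymm (sSup_le fun y (hy : n y = n x) => hy ▸ n.le_apply) ?_
    exact (ofNucleus n).le_toNucleus (n.idempotent x)
  map_rel_iff' {θ φ} := by
    constructor
    · intro h x y hxy
      have aux : ∀ {a b}, θ.rel a b → φ.toNucleus a ≤ φ.toNucleus b := by
        intro a b hab
        rw [← φ.toNucleus.idempotent b]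
        exact φ.toNucleus.monotone ((θ.le_toNucleus hab).trans (h b))
      exact (φ.rel_iff x y).2 (le_antisymm (aux hxy) (aux (θ.symm' hxy)))
    · intro h x
      exact φ.le_toNucleus (h _ _ (θ.toNucleus_rel x))

/-- The congruences of a frame form a frame. -/
instance : Order.Frame (FrameCongruence L) :=
  .ofMinimalAxioms
    { inf_sSup_le_iSup_inf := fun θ A => by
        rw [← (nucleusIso (L := L)).le_iff_le]
        simp only [OrderIso.map_inf, OrderIso.map_sSup, OrderIso.map_iSup, inf_iSup_eq]
        exact le_rfl }

/-- The closed congruence `∇ a`. -/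
def closed (a : L) : FrameCongruence L where
  rel x y := a ⊔ x = a ⊔ y
  refl' _ := rfl
  symm' h := h.symm
  trans' h₁ h₂ := h₁.trans h₂
  inf' h₁ h₂ := by rw [sup_inf_left, sup_inf_left, h₁, h₂]
  iSup' {ι f g} h := by
    have key : ∀ f g : ι → L, (∀ i, a ⊔ f i = a ⊔ g i) → a ⊔ ⨆ i, f i ≤ a ⊔ ⨆ i, g i := by
      intro f g h
      refine sup_le le_sup_left (iSup_le fun i => ?_)
      exact le_sup_right.trans ((h i).le.trans (sup_le_sup_left (le_iSup g i) a))
    exact le_antisymm (key f g h) (key g f fun i => (h i).symm)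

/-- The open congruence `Δ a`. -/
def opn (a : L) : FrameCongruence L where
  rel x y := a ⊓ x = a ⊓ y
  refl' _ := rfl
  symm' h := h.symm
  trans' h₁ h₂ := h₁.trans h₂
  inf' {x y z w} h₁ h₂ := by
    rw [inf_inf_distrib_left a x z, inf_inf_distrib_left a y w, h₁, h₂]
  iSup' h := by simp only [inf_iSup_eq, h]

theorem closed_le_iff (a : L) (θ : FrameCongruence L) : closed a ≤ θ ↔ θ.rel a ⊥ := by
  constructor
  · intro h
    exact h _ _ (show a ⊔ a = a ⊔ ⊥ by simp)
  · intro h x y (hxy : a ⊔ x = a ⊔ y)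
    rw [rel_iff] at h ⊢
    have key : ∀ z, θ.toNucleus (a ⊔ z) = θ.toNucleus z := fun z => by
      refine le_antisymm ?_ (θ.toNucleus.monotone le_sup_right)
      rw [← θ.toNucleus.idempotent z]
      refine θ.toNucleus.monotone (sup_le ?_ θ.toNucleus.le_apply)
      exact θ.toNucleus.le_apply.trans (h.le.trans (θ.toNucleus.monotone bot_le))
    rw [← key x, ← key y, hxy]

theorem opn_le_iff (a : L) (θ : FrameCongruence L) : opn a ≤ θ ↔ θ.rel a ⊤ := by
  constructor
  · intro h
    exact h _ _ (show a ⊓ a = a ⊓ ⊤ by simp)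
  · intro h x y (hxy : a ⊓ x = a ⊓ y)
    have h₁ := θ.inf' h (θ.refl' x)
    have h₂ := θ.inf' h (θ.refl' y)
    rw [top_inf_eq] at h₁ h₂
    rw [hxy] at h₁
    exact θ.trans' (θ.symm' h₁) h₂

theorem closed_sSup (A : Set L) : closed (sSup A) = sSup (closed '' A) := by
  refine le_antisymm ?_ (sSup_le ?_)
  · have h := (sSup (closed '' A)).iSup' (f := fun a : A => a.1) (g := fun _ => ⊥) fun a =>
      (closed_le_iff _ _).1 (le_sSup (Set.mem_image_of_mem _ a.2))
    rwa [iSup_bot, ← sSup_eq_iSup', ← closed_le_iff] at h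
  · rintro _ ⟨a, ha, rfl⟩
    rw [closed_le_iff]
    change sSup A ⊔ a = sSup A ⊔ ⊥
    rw [sup_bot_eq, sup_eq_left]
    exact le_sSup ha

theorem isCompl_closed_opn (a : L) : IsCompl (closed a) (opn a) := by
  constructor
  · rw [disjoint_iff_inf_le]
    intro x y h
    have h₁ : a ⊔ x = a ⊔ y := (inf_le_left : closed a ⊓ opn a ≤ _) x y h
    have h₂ : a ⊓ x = a ⊓ y := (inf_le_right : closed a ⊓ opn a ≤ _) x y h
    have : x = y := eq_of_inf_eq_sup_eq (a := a) (by rw [inf_comm, h₂, inf_comm])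
      (by rw [sup_comm, h₁, sup_comm])
    rw [this]
    exact (⊥ : FrameCongruence L).refl' y
  · rw [codisjoint_iff_le_sup]
    intro x y _
    have h₁ : (closed a ⊔ opn a).rel a ⊥ := (closed_le_iff _ _).1 le_sup_left
    have h₂ : (closed a ⊔ opn a).rel a ⊤ := (opn_le_iff _ _).1 le_sup_right
    have h := (closed a ⊔ opn a).trans' ((closed a ⊔ opn a).symm' h₁) h₂
    have hx := (closed a ⊔ opn a).inf' h ((closed a ⊔ opn a).refl' x)
    have hy := (closed a ⊔ opn a).inf' h ((closed a ⊔ opn a).refl' y)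
    simp only [bot_inf_eq, top_inf_eq] at hx hy
    exact (closed a ⊔ opn a).trans' ((closed a ⊔ opn a).symm' hx) hy

end FrameCongruence

/-! ### Generated subframes -/

/-- Membership in the subframe generated by `G`. -/
inductive SubframeGen {F : Type u} [Order.Frame F] (G : Set F) : F → Prop
  | basic (a : F) (h : a ∈ G) : SubframeGen G a
  | top : SubframeGen G ⊤
  | inf (a b : F) (ha : SubframeGen G a) (hb : SubframeGen G b) : SubframeGen G (a ⊓ b)
  | sSup (A : Set F) (h : ∀ a ∈ A, SubframeGen G a) : SubframeGen G (sSup A)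

/-- The subframe generated by `G`. -/
@[ext]
structure Subframe {F : Type u} [Order.Frame F] (G : Set F) where
  /-- The underlying element. -/
  val : F
  property : SubframeGen G val

namespace Subframe

variable {F : Type u} [Order.Frame F] (G : Set F)

instance : PartialOrder (Subframe G) where
  le a b := a.val ≤ b.val
  le_refl _ := le_refl (α := F) _
  le_trans _ _ _ h₁ h₂ := le_trans (α := F) h₁ h₂
  le_antisymm _ _ h₁ h₂ := Subframe.ext (le_antisymm (α := F) h₁ h₂)

instance : SupSet (Subframe G) where
  sSup A := ⟨sSup (Subframe.val '' A), .sSup _ (by rintro _ ⟨a, _, rfl⟩; exact a.property)⟩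

instance : CompleteLattice (Subframe G) :=
  { completeLatticeOfSup (Subframe G) fun A =>
      ⟨fun a ha => le_sSup (α := F) (Set.mem_image_of_mem _ ha), fun b hb =>
        sSup_le (α := F) (by rintro _ ⟨a, ha, rfl⟩; exact hb ha)⟩ with
    inf := fun a b => ⟨a.val ⊓ b.val, .inf _ _ a.property b.property⟩
    inf_le_left := fun a b => inf_le_left (α := F)
    inf_le_right := fun a b => inf_le_right (α := F)
    le_inf := fun a b c h₁ h₂ => le_inf (α := F) h₁ h₂
    top := ⟨⊤, .top⟩
    le_top := fun a => le_top (α := F) }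

theorem val_le {a b : Subframe G} : a ≤ b ↔ a.val ≤ b.val := Iff.rfl

theorem val_top : (⊤ : Subframe G).val = ⊤ := rfl

theorem val_inf (a b : Subframe G) : (a ⊓ b).val = a.val ⊓ b.val := rfl

theorem val_sSup (A : Set (Subframe G)) : (sSup A).val = sSup (Subframe.val '' A) := rfl

instance : Order.Frame (Subframe G) :=
  .ofMinimalAxioms
    { inf_sSup_le_iSup_inf := fun a A => by
        rw [val_le, val_inf, val_sSup, inf_sSup_eq]
        refine iSup₂_le ?_
        rintro _ ⟨b, hb, rfl⟩
        exact (val_le G).1 (le_iSup₂ (f := fun (b : Subframe G) (_ : b ∈ A) => a ⊓ b) b hb) }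

end Subframe

/-! ### Symmetrization and completeness of Frith frames -/

namespace FrithFrame

open FrameCongruence

/-- The closed congruences `∇ a`, for `a ∈ L`, and the open ones `Δ s`, for `s ∈ S`. -/
def symGenerators (L : FrithFrame.{u}) : Set (FrameCongruence L) :=
  Set.range closed ∪ opn '' L.lat

/-- The frame `C_S L`: the subframe of the frame of congruences of `L` generated by the closed
congruences and the open congruences of the elements of `S`. -/
abbrev SymFrame (L : FrithFrame.{u}) : Type u := Subframe L.symGenerators

/-- `∇ a` as an element of `C_S L`. -/
def symClosed (L : FrithFrame.{u}) (a : L) : L.SymFrame :=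
  ⟨closed a, .basic _ (Or.inl ⟨a, rfl⟩)⟩

/-- `Δ s`, for `s ∈ S`, as an element of `C_S L`. -/
def symOpen (L : FrithFrame.{u}) (s : L.lat) : L.SymFrame :=
  ⟨opn s.1, .basic _ (Or.inr ⟨s.1, s.2, rfl⟩)⟩

/-- The sublattice of `C_S L` generated by the `∇ s` with `s ∈ S` and their complements `Δ s`. -/
def symLattice (L : FrithFrame.{u}) : Set L.SymFrame :=
  latticeClosure (L.symClosed '' L.lat ∪ Set.range L.symOpen)

theorem symClosed_mem (L : FrithFrame.{u}) {s : L} (hs : s ∈ L.lat) :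
    L.symClosed s ∈ L.symLattice :=
  subset_latticeClosure (Or.inl ⟨s, hs, rfl⟩)

theorem symOpen_mem (L : FrithFrame.{u}) (s : L.lat) : L.symOpen s ∈ L.symLattice :=
  subset_latticeClosure (Or.inr ⟨s, rfl⟩)

theorem symClosed_sSup (L : FrithFrame.{u}) (A : Set L) :
    L.symClosed (sSup A) = sSup (L.symClosed '' A) := by
  apply Subframe.ext
  rw [Subframe.val_sSup, Set.image_image]
  exact closed_sSup A

theorem symClosed_top (L : FrithFrame.{u}) : L.symClosed ⊤ = ⊤ := by
  refine top_le_iff.1 fun x y _ => ?_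
  change ⊤ ⊔ x = ⊤ ⊔ y
  rw [top_sup_eq, top_sup_eq]

theorem symClosed_bot (L : FrithFrame.{u}) : L.symClosed ⊥ = ⊥ := by
  simpa using L.symClosed_sSup ∅

/-- The symmetric reflection of a Frith frame `(L, S)`: the frame `C_S L` with its sublattice
generated by the `∇ s` with `s ∈ S` and their complements. -/
def symmetrization (L : FrithFrame.{u}) : FrithFrame.{u} where
  carrier := L.SymFrame
  lat := L.symLattice
  top_mem := L.symClosed_top ▸ L.symClosed_mem L.top_mem
  bot_mem := L.symClosed_bot ▸ L.symClosed_mem L.bot_mem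
  inf_mem ha hb := isSublattice_latticeClosure.infClosed ha hb
  sup_mem ha hb := isSublattice_latticeClosure.supClosed ha hb
  join_dense := by
    rintro ⟨a, ha⟩
    induction ha with
    | basic a h =>
      rcases h with ⟨b, rfl⟩ | ⟨s, hs, rfl⟩
      · obtain ⟨A, hA, rfl⟩ := L.join_dense b
        exact ⟨L.symClosed '' A, by rintro _ ⟨s, hs, rfl⟩; exact L.symClosed_mem (hA hs),
          (L.symClosed_sSup A).symm⟩
      · exact ⟨{L.symOpen ⟨s, hs⟩}, by rintro _ rfl; exact L.symOpen_mem _, sSup_singleton⟩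
    | top => exact ⟨{⊤}, by rintro _ rfl; exact L.symClosed_top ▸ L.symClosed_mem L.top_mem,
        sSup_singleton⟩
    | inf a b ha hb iha ihb =>
      obtain ⟨A, hA, hA'⟩ := iha
      obtain ⟨B, hB, hB'⟩ := ihb
      refine ⟨(fun p : L.SymFrame × L.SymFrame => p.1 ⊓ p.2) '' (A ×ˢ B), ?_, ?_⟩
      · rintro _ ⟨⟨p, q⟩, ⟨hp, hq⟩, rfl⟩
        exact isSublattice_latticeClosure.infClosed (hA hp) (hB hq)
      · rw [sSup_image, ← sSup_inf_sSup, hA', hB']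
        rfl
    | sSup A h ih =>
      choose B hB hB' using ih
      refine ⟨⋃ (a) (ha : a ∈ A), B a ha, by simpa using hB, ?_⟩
      refine le_antisymm (sSup_le ?_) ?_
      · intro b hb
        simp only [Set.mem_iUnion] at hb
        obtain ⟨a, ha, hb⟩ := hb
        refine le_trans (le_sSup hb) ?_
        rw [hB' a ha]
        exact le_sSup (α := FrameCongruence L) ha
      · refine sSup_le (α := FrameCongruence L) fun a ha => ?_
        have h₁ : (⟨a, h a ha⟩ : L.SymFrame) ≤ sSup (⋃ (a) (ha : a ∈ A), B a ha) := by
          rw [← hB' a ha]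
          exact sSup_le_sSup (Set.subset_iUnion₂ a ha)
        exact h₁

/-- Completeness for a symmetric Frith frame. -/
def IsCompleteOfSymmetric (L : FrithFrame.{u}) : Prop :=
  ∀ (M : FrithFrame.{u}) (h : M ⟶ L), M.IsSymmetric → IsDense h → IsExtremalEpi h → IsIso h

/-- A Frith frame is complete when its symmetric reflection is. -/
def IsComplete (L : FrithFrame.{u}) : Prop := L.symmetrization.IsCompleteOfSymmetric

end FrithFrame

/-- The property of being a complete Frith frame. -/
def CompleteFrith : ObjectProperty FrithFrame.{u} := fun L => L.IsComplete

/-! ### The dual adjunction -/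

namespace PervinFrith

open TopologicalSpace

theorem exists_sUnion_of_isOpen (X : Pervin.{u}) {U : Set X} (hU : IsOpen U) :
    ∃ A ⊆ X.sets, ⋃₀ A = U := by
  have hb : IsTopologicalBasis X.sets :=
    { exists_subset_inter := fun A hA B hB x hx => ⟨A ∩ B, X.inter_mem hA hB, hx, le_rfl⟩
      sUnion_eq := Set.eq_univ_of_univ_subset (Set.subset_sUnion_of_mem X.univ_mem)
      eq_generateFrom := rfl }
  obtain ⟨A, hA, rfl⟩ := hb.open_eq_sUnion hU
  exact ⟨A, hA, rfl⟩

/-- The Frith frame `(Ω_S(X), S)` of a Pervin space `(X, S)`. -/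
def opensFrith (X : Pervin.{u}) : FrithFrame.{u} where
  carrier := Opens X
  lat := {U | (U : Set X) ∈ X.sets}
  top_mem := X.univ_mem
  bot_mem := X.empty_mem
  inf_mem := X.inter_mem
  sup_mem := X.union_mem
  join_dense U := by
    obtain ⟨A, hA, hU⟩ := exists_sUnion_of_isOpen X U.isOpen
    refine ⟨{V | (V : Set X) ∈ A}, fun V hV => hA hV, ?_⟩
    ext x
    simp only [Opens.coe_sSup, Set.mem_iUnion, ← hU, Set.mem_sUnion, SetLike.mem_coe]
    constructor
    · rintro ⟨V, hV, hx⟩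
      exact ⟨V, hV, hx⟩
    · rintro ⟨V, hV, hx⟩
      exact ⟨⟨V, isOpen_generateFrom_of_mem (hA hV)⟩, hV, hx⟩

/-- The functor `Ω` from Pervin spaces to the opposite of Frith frames; it sends a morphism to its
preimage map. -/
def Omega : Pervin.{u} ⥤ FrithFrame.{u}ᵒᵖ where
  obj X := op (opensFrith X)
  map {X Y} f := Quiver.Hom.op (X := opensFrith Y) (Y := opensFrith X)
    ⟨Opens.comap ⟨f.toFun, Pervin.Hom.continuous f⟩, fun (T : Opens Y) hT => f.preimage_mem (T : Set Y) hT⟩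

/-- The Pervin space `(pt(L), Ŝ)` of points of a Frith frame `(L, S)`. Points are frame
homomorphisms to the two-element frame `Prop`. -/
def ptPervin (L : FrithFrame.{u}) : Pervin.{u} where
  carrier := FrameHom L Prop
  sets := {A | ∃ s ∈ L.lat, {p : FrameHom L Prop | p s} = A}
  univ_mem := ⟨⊤, L.top_mem, by ext p; simp⟩
  empty_mem := ⟨⊥, L.bot_mem, by ext p; simp⟩
  inter_mem := by
    rintro _ _ ⟨s, hs, rfl⟩ ⟨t, ht, rfl⟩
    exact ⟨s ⊓ t, L.inf_mem hs ht, by ext p; simp⟩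
  union_mem := by
    rintro _ _ ⟨s, hs, rfl⟩ ⟨t, ht, rfl⟩
    exact ⟨s ⊔ t, L.sup_mem hs ht, by ext p; simp⟩

/-- The functor `pt` from the opposite of Frith frames to Pervin spaces; it sends a morphism `h`
to precomposition with `h`. -/
def pt : FrithFrame.{u}ᵒᵖ ⥤ Pervin.{u} where
  obj L := ptPervin L.unop
  map {L M} h :=
    { toFun := fun p : FrameHom L.unop Prop => p.comp h.unop.toFrameHom
      preimage_mem := by
        rintro _ ⟨s, hs, rfl⟩
        exact ⟨h.unop.toFrameHom s, h.unop.map_mem s hs, rfl⟩ }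

/-- The unit of the adjunction: a point `x` is sent to the point `U ↦ (x ∈ U)`. -/
def unitHom (X : Pervin.{u}) : X ⟶ ptPervin (opensFrith X) where
  toFun x := Locale.localePointOfSpacePoint X x
  preimage_mem := by
    rintro _ ⟨U, hU, rfl⟩
    exact hU

/-- The set of the points of `L` that hold at `a`. -/
def pointsAt (L : FrithFrame.{u}) (a : L) : Set (ptPervin L) := {p : FrameHom L Prop | p a}

theorem mem_pointsAt (L : FrithFrame.{u}) (a : L) (p : FrameHom L Prop) :
    (show ptPervin L from p) ∈ pointsAt L a ↔ p a := Iff.rfl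

theorem pointsAt_sSup (L : FrithFrame.{u}) (A : Set L) :
    pointsAt L (sSup A) = ⋃ s ∈ A, pointsAt L s := by
  refine Set.ext fun (p : FrameHom L Prop) => (mem_pointsAt L _ p).trans ?_
  have h : p (sSup A) ↔ ∃ s, ∃ _ : s ∈ A, p s := by
    rw [map_sSup, sSup_image]
    simp only [iSup_Prop_eq]
  exact h.trans (Set.mem_iUnion₂ (γ := ptPervin L) (s := fun s (_ : s ∈ A) => pointsAt L s)).symm

theorem isOpen_pointsAt (L : FrithFrame.{u}) (a : L) : IsOpen (pointsAt L a) := by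
  obtain ⟨A, hA, rfl⟩ := L.join_dense a
  rw [pointsAt_sSup]
  exact isOpen_biUnion fun s hs => isOpen_generateFrom_of_mem ⟨s, hA hs, rfl⟩

/-- The frame homomorphism that sends an element `a` to the open set of the points that hold
at `a`. -/
def pointsFrameHom (L : FrithFrame.{u}) : FrameHom L (Opens (ptPervin L)) where
  toFun a := ⟨pointsAt L a, isOpen_pointsAt L a⟩
  map_inf' a b := Opens.ext <| Set.ext fun (p : FrameHom L Prop) => iff_of_eq (map_inf p a b)
  map_top' := Opens.ext <| Set.ext fun (p : FrameHom L Prop) => iff_of_eq (map_top p)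
  map_sSup' A := by
    refine Opens.ext ?_
    rw [Opens.coe_sSup, Set.biUnion_image]
    exact pointsAt_sSup L A

/-- The counit of the adjunction. -/
def counitHom (L : FrithFrame.{u}) : L ⟶ opensFrith (ptPervin L) where
  toFrameHom := pointsFrameHom L
  map_mem s hs := ⟨s, hs, rfl⟩

/-- The dual adjunction `Ω ⊣ pt` between Pervin spaces and Frith frames. -/
def adjunction : Omega.{u} ⊣ pt.{u} where
  unit := { app := unitHom, naturality := fun _ _ _ => rfl }
  counit := { app := fun L => (counitHom L.unop).op, naturality := fun _ _ _ => rfl }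
  left_triangle_components _ := rfl
  right_triangle_components _ := rfl

/-! ### Restrictions to the full subcategories -/

/-- The functor `Ω` restricted and corestricted to `T₀` complete Pervin spaces and complete Frith
frames. -/
def restrictOmega (hΩ : ∀ X : Pervin.{u}, T0Complete X → CompleteFrith (Omega.obj X).unop) :
    T0Complete.{u}.FullSubcategory ⥤ CompleteFrith.{u}.FullSubcategoryᵒᵖ where
  obj X := op ⟨(Omega.obj X.obj).unop, hΩ X.obj X.property⟩
  map f := (ObjectProperty.homMk (Omega.map f.hom).unop).op

/-- The functor `pt` restricted and corestricted to complete Frith frames and `T₀` complete Pervin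
spaces. -/
def restrictPt (hpt : ∀ L : FrithFrame.{u}, CompleteFrith L → T0Complete (pt.obj (op L))) :
    CompleteFrith.{u}.FullSubcategoryᵒᵖ ⥤ T0Complete.{u}.FullSubcategory where
  obj L := ⟨pt.obj (op L.unop.obj), hpt L.unop.obj L.unop.property⟩
  map h := ObjectProperty.homMk (pt.map h.unop.hom.op)

/-- The adjunction `Ω ⊣ pt` restricted to the full subcategories of `T₀` complete Pervin spaces
and complete Frith frames; its unit and counit are those of `Ω ⊣ pt`. -/
def restrictAdjunction
    (hΩ : ∀ X : Pervin.{u}, T0Complete X → CompleteFrith (Omega.obj X).unop)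
    (hpt : ∀ L : FrithFrame.{u}, CompleteFrith L → T0Complete (pt.obj (op L))) :
    restrictOmega hΩ ⊣ restrictPt hpt where
  unit :=
    { app := fun X => ObjectProperty.homMk (adjunction.unit.app X.obj)
      naturality := fun _ _ _ => rfl }
  counit :=
    { app := fun L => Quiver.Hom.op (ObjectProperty.homMk (adjunction.counit.app
        (op L.unop.obj)).unop)
      naturality := fun _ _ _ => rfl }
  left_triangle_components _ := rfl
  right_triangle_components _ := rfl

end PervinFrith

/-! Both completeness conditions are compactness conditions in disguise. A prime ideal is read
throughout as the collection of lattice elements that fail at a would-be point, and completeness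
says that the point exists.

For frames, `(L, S)` is complete exactly when the elements of `S` are compact in `L`
(`isComplete_iff_isCoherent`). In the symmetric case, the join map from the frame of ideals of `S`
to `L` is dense and maps its lattice onto `S`; if it is injective, the elements of `S` are compact.
Conversely, complements, density and compactness force a test morphism to be injective. Compactness
descends from `C_S L` to `L` along the embedding `∇`, and ascends by the Prime Ideal Theorem, using
kernels of points of `L` (`IsCoherent.exists_frameCongruence`).

For spaces, the test object is the space of prime ideals of the Boolean algebra generated by the
lattice. The symmetrization of a `T₀` space embeds densely in it, so completeness realizes every
prime ideal by a point (`exists_point_of_isPrimeIdealOn`). Separation by prime ideals then shows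
that the sets of the lattice are compact, so that `Ω` lands in complete frames, and that every point
of the frame of opens is given by a unique point of the space, so that the unit is invertible and
the space is sober.

When `S` is compact, prime ideals of `S` give points of `L` (`IsCoherent.exists_point`). Hence `L`
has enough points, which gives spatiality and the invertible counit, and `pt(L, S)` is complete
(`isComplete_ptPervin`). -/

/-! ### Prime ideals of sublattices -/

section PrimeIdeals

variable {α : Type u}

/-- The trace on a sublattice `S` of `J` is a prime ideal of `S`. -/
structure IsPrimeIdealOn [Lattice α] [BoundedOrder α] (S : Sublattice α) (J : Set α) : Prop where
  bot_mem : ⊥ ∈ J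
  top_notMem : ⊤ ∉ J
  sup_mem_iff : ∀ {a b}, a ∈ S → b ∈ S → (a ⊔ b ∈ J ↔ a ∈ J ∧ b ∈ J)
  inf_mem_iff : ∀ {a b}, a ∈ S → b ∈ S → (a ⊓ b ∈ J ↔ a ∈ J ∨ b ∈ J)

theorem IsPrimeIdealOn.mem_of_le [Lattice α] [BoundedOrder α] {S : Sublattice α} {J : Set α}
    (hJ : IsPrimeIdealOn S J) {a b : α} (ha : a ∈ S) (hb : b ∈ S) (hab : a ≤ b) (h : b ∈ J) :
    a ∈ J := by
  rw [← sup_eq_right.2 hab] at h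
  exact ((hJ.sup_mem_iff ha hb).1 h).1

theorem IsPrimeIdealOn.compl_mem_iff [BooleanAlgebra α] {S : Sublattice α} {J : Set α}
    (hJ : IsPrimeIdealOn S J) {a : α} (ha : a ∈ S) (ha' : aᶜ ∈ S) : aᶜ ∈ J ↔ a ∉ J := by
  constructor
  · intro h h'
    exact hJ.top_notMem (sup_compl_eq_top (x := a) ▸ (hJ.sup_mem_iff ha ha').2 ⟨h', h⟩)
  · intro h
    exact ((hJ.inf_mem_iff ha ha').1 (inf_compl_eq_bot (a := a) ▸ hJ.bot_mem)).resolve_left h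

/-- Only members in `S` matter. Cutting `J` down to `S` makes prime ideals with the same trace
equal, as the space of prime ideals needs in order to be `T₀`. -/
theorem IsPrimeIdealOn.inter [Lattice α] [BoundedOrder α] {S : Sublattice α} {J : Set α}
    (hJ : IsPrimeIdealOn S J) (hS : ⊥ ∈ S) : IsPrimeIdealOn S (J ∩ S) where
  bot_mem := ⟨hJ.bot_mem, hS⟩
  top_notMem h := hJ.top_notMem h.1
  sup_mem_iff ha hb := by
    simp [ha, hb, S.sup_mem ha hb, hJ.sup_mem_iff ha hb]
  inf_mem_iff ha hb := by
    simp [ha, hb, S.inf_mem ha hb, hJ.inf_mem_iff ha hb]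

theorem isPrimeIdealOn_notMem (S : Sublattice (Set α)) (x : α) :
    IsPrimeIdealOn S {U | x ∉ U} where
  bot_mem := id
  top_notMem h := h trivial
  sup_mem_iff _ _ := not_or
  inf_mem_iff _ _ := not_and_or

/-- The ideal of the elements below some element of a directed set. -/
def directedIdeal [Preorder α] (D : Set α) (hne : D.Nonempty) (hD : DirectedOn (· ≤ ·) D) :
    Order.Ideal α where
  carrier := {a | ∃ d ∈ D, a ≤ d}
  lower' := fun _ _ hab ⟨d, hd, h⟩ => ⟨d, hd, hab.trans h⟩
  nonempty' := hne.elim fun d hd => ⟨d, d, hd, le_rfl⟩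
  directed' := by
    rintro a ⟨d, hd, hda⟩ b ⟨e, he, heb⟩
    obtain ⟨f, hf, hdf, hef⟩ := hD d hd e he
    exact ⟨f, ⟨f, hf, le_rfl⟩, hda.trans hdf, heb.trans hef⟩

/-- An element of a sublattice outside of an ideal is separated from the ideal by a prime ideal of
the sublattice. -/
theorem PrimeIdealTheorem.exists_isPrimeIdealOn (pit : PrimeIdealTheorem.{u}) [DistribLattice α]
    [BoundedOrder α] (S : Sublattice α) (hbot : ⊥ ∈ S) (I : Order.Ideal α) {s : α} (hs : s ∈ S)
    (hsI : s ∉ I) : ∃ J : Set α, IsPrimeIdealOn S J ∧ (∀ a ∈ S, a ∈ I → a ∈ J) ∧ s ∉ J := by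
  -- In the part of `S` below `s`, the top is `s` itself, so `s ∉ I` becomes properness of the trace
  -- of `I`, and any prime ideal of this part avoids `s`.
  let T : Sublattice α :=
    { carrier := {a | a ∈ S ∧ a ≤ s}
      supClosed' := fun a ha b hb => ⟨S.sup_mem ha.1 hb.1, sup_le ha.2 hb.2⟩
      infClosed' := fun a ha b hb => ⟨S.inf_mem ha.1 hb.1, inf_le_left.trans ha.2⟩ }
  let _ : BoundedOrder T :=
    { top := ⟨s, hs, le_rfl⟩
      le_top := fun a => a.2.2
      bot := ⟨⊥, hbot, bot_le⟩
      bot_le := fun a => bot_le (α := α) }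
  let I' : Order.Ideal T :=
    { carrier := {a | a.1 ∈ I}
      lower' := fun a b hab ha => I.lower (show b.1 ≤ a.1 from hab) ha
      nonempty' := ⟨⊥, I.bot_mem⟩
      directed' := fun a ha b hb => ⟨a ⊔ b, Order.Ideal.sup_mem (s := I) ha hb,
        le_sup_left, le_sup_right⟩ }
  obtain ⟨J, hIJ, hJ⟩ := pit T I' (Order.Ideal.isProper_of_notMem (p := ⊤) hsI)
  have hT : ∀ {a}, a ∈ S → a ⊓ s ∈ T := fun ha => ⟨S.inf_mem ha hs, inf_le_right⟩
  have htop : (⟨s, hs, le_rfl⟩ : T) ∉ J := Order.Ideal.isProper_iff_top_notMem.1 hJ.toIsProper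
  have key : ∀ {a} (h : a ∈ S) (b : T), b.1 = a ⊓ s →
      (a ∈ {a | ∃ h : a ⊓ s ∈ T, (⟨a ⊓ s, h⟩ : T) ∈ J} ↔ b ∈ J) := by
    rintro a h ⟨b, hb⟩ rfl
    exact ⟨fun ⟨_, h⟩ => h, fun h => ⟨hb, h⟩⟩
  -- The prime ideal is pulled back along the lattice homomorphism `a ↦ a ⊓ s`.
  refine ⟨{a | ∃ h : a ⊓ s ∈ T, (⟨a ⊓ s, h⟩ : T) ∈ J}, ⟨?_, ?_, ?_, ?_⟩, ?_, ?_⟩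
  · exact (key hbot ⊥ (bot_inf_eq s).symm).2 J.bot_mem
  · rintro ⟨h, h'⟩
    exact htop (by convert h'; exact (top_inf_eq s).symm)
  · intro a b ha hb
    rw [key ha ⟨_, hT ha⟩ rfl, key hb ⟨_, hT hb⟩ rfl, ← Order.Ideal.sup_mem_iff]
    exact key (S.sup_mem ha hb) _ (inf_sup_right a b s).symm
  · intro a b ha hb
    rw [key ha ⟨_, hT ha⟩ rfl, key hb ⟨_, hT hb⟩ rfl]
    refine (key (S.inf_mem ha hb) (⟨_, hT ha⟩ ⊓ ⟨_, hT hb⟩) (inf_inf_distrib_right a b s).symm).trans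
      ⟨hJ.mem_or_mem, fun h => ?_⟩
    exact h.elim (J.lower inf_le_left) (J.lower inf_le_right)
  · exact fun a ha haI => ⟨hT ha, hIJ (show (⟨a ⊓ s, hT ha⟩ : T) ∈ I' from I.lower inf_le_left haI)⟩
  · exact fun h => htop ((key hs _ (inf_idem s).symm).1 h)

end PrimeIdeals

/-! ### Isomorphisms and monomorphisms of Pervin spaces -/

namespace Pervin

theorem inseparable_iff {X : Pervin.{u}} {x y : X} :
    Inseparable x y ↔ ∀ s ∈ X.sets, x ∈ s ↔ y ∈ s := by
  rw [inseparable_iff_forall_isOpen]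
  constructor
  · exact fun h s hs => h s (TopologicalSpace.isOpen_generateFrom_of_mem hs)
  · intro h U hU
    obtain ⟨A, hA, rfl⟩ := PervinFrith.exists_sUnion_of_isOpen X hU
    exact exists_congr fun s => and_congr_right fun hs => h s (hA hs)

theorem isT0_iff {X : Pervin.{u}} :
    X.IsT0 ↔ ∀ x y : X, (∀ s ∈ X.sets, x ∈ s ↔ y ∈ s) → x = y := by
  simp only [IsT0, t0Space_iff_inseparable, inseparable_iff]

theorem isDense_of_forall_mem {X Y : Pervin.{u}} (f : X ⟶ Y)
    (h : ∀ T ∈ Y.sets, T.Nonempty → ∃ x, f.toFun x ∈ T) : IsDense f := by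
  refine dense_iff_inter_open.2 fun U hU ⟨y, hy⟩ => ?_
  obtain ⟨A, hA, rfl⟩ := PervinFrith.exists_sUnion_of_isOpen Y hU
  obtain ⟨T, hT, hyT⟩ := hy
  obtain ⟨x, hx⟩ := h T (hA hT) ⟨y, hyT⟩
  exact ⟨f.toFun x, ⟨T, hT, hx⟩, x, rfl⟩

theorem isIso_of_bijective {X Y : Pervin.{u}} (f : X ⟶ Y) (hf : Function.Bijective f.toFun)
    (h : ∀ S ∈ X.sets, ∃ T ∈ Y.sets, f.toFun ⁻¹' T = S) : IsIso f := by
  let e := Equiv.ofBijective f.toFun hf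
  let g : Y ⟶ X := Hom.mk (X := Y) (Y := X) e.symm fun S hS => by
    obtain ⟨T, hT, rfl⟩ := h S hS
    convert hT
    ext y
    exact iff_of_eq (congrArg (· ∈ T) (e.apply_symm_apply y))
  exact ⟨g, hom_ext fun x => e.symm_apply_apply x, hom_ext fun y => e.apply_symm_apply y⟩

theorem bijective_of_isIso {X Y : Pervin.{u}} (f : X ⟶ Y) [IsIso f] :
    Function.Bijective f.toFun :=
  Function.bijective_iff_has_inverse.2 ⟨(inv f).toFun,
    fun x => congrFun (congrArg Hom.toFun (IsIso.hom_inv_id f)) x,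
    fun x => congrFun (congrArg Hom.toFun (IsIso.inv_hom_id f)) x⟩

theorem exists_preimage_eq_of_isIso {X Y : Pervin.{u}} (f : X ⟶ Y) [IsIso f] {S : Set X}
    (hS : S ∈ X.sets) : ∃ T ∈ Y.sets, f.toFun ⁻¹' T = S := by
  refine ⟨(inv f).toFun ⁻¹' S, (inv f).preimage_mem S hS, ?_⟩
  rw [← Set.preimage_comp, ← comp_toFun, IsIso.hom_inv_id]
  rfl

theorem mono_of_injective {X Y : Pervin.{u}} (f : X ⟶ Y) (hf : Function.Injective f.toFun) :
    Mono f :=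
  ⟨fun _ _ e => hom_ext fun z => hf (congrFun (congrArg Hom.toFun e) z)⟩

theorem epi_of_surjective {X Y : Pervin.{u}} (f : X ⟶ Y) (hf : Function.Surjective f.toFun) :
    Epi f :=
  ⟨fun _ _ e => hom_ext <| hf.forall.2 fun x => congrFun (congrArg Hom.toFun e) x⟩

/-- The Pervin space of all subsets of a set. -/
def discrete (X : Type u) : Pervin.{u} where
  carrier := X
  sets := Set.univ
  univ_mem := trivial
  empty_mem := trivial
  inter_mem _ _ := trivial
  union_mem _ _ := trivial

/-- The Pervin space of a set with the two-element lattice. -/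
def indiscrete (X : Type u) : Pervin.{u} where
  carrier := X
  sets := {∅, Set.univ}
  univ_mem := Or.inr rfl
  empty_mem := Or.inl rfl
  inter_mem := by rintro _ _ (rfl | rfl) (rfl | rfl) <;> simp
  union_mem := by rintro _ _ (rfl | rfl) (rfl | rfl) <;> simp

theorem injective_of_mono {X Y : Pervin.{u}} (f : X ⟶ Y) [Mono f] :
    Function.Injective f.toFun := by
  intro x y hxy
  -- Every function out of a discrete space is a morphism, so points of `X` are morphisms from the
  -- one-point space.
  let p (x : X) : discrete PUnit ⟶ X := Hom.mk (X := discrete PUnit) (fun _ => x) fun _ _ => trivial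
  have h : p x = p y := (cancel_mono f).1 (hom_ext fun _ => hxy)
  exact congrFun (congrArg Hom.toFun h) PUnit.unit

theorem surjective_of_epi {X Y : Pervin.{u}} (f : X ⟶ Y) [Epi f] :
    Function.Surjective f.toFun := by
  -- Every function into an indiscrete space is a morphism. The indicator of the image of `f` and
  -- the constant `True` agree after composition with `f`.
  let c (p : Y → ULift.{u} Prop) : Y ⟶ indiscrete (ULift.{u} Prop) :=
    Hom.mk (Y := indiscrete (ULift.{u} Prop)) p <| by
      rintro _ (rfl | rfl)
      exacts [Y.empty_mem, Y.univ_mem]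
  have h : c (fun y => ⟨∃ x, f.toFun x = y⟩) = c fun _ => ⟨True⟩ :=
    (cancel_epi f).1 (hom_ext fun x => congrArg ULift.up (eq_true ⟨x, rfl⟩))
  exact fun y => of_eq_true (congrArg ULift.down (congrFun (congrArg Hom.toFun h) y))

/-- Extremal monomorphisms of Pervin spaces are the embeddings. -/
theorem isExtremalMono_iff {X Y : Pervin.{u}} (f : X ⟶ Y) :
    IsExtremalMono f ↔
      Function.Injective f.toFun ∧ ∀ S ∈ X.sets, ∃ T ∈ Y.sets, f.toFun ⁻¹' T = S := by
  constructor
  · rintro ⟨_, h⟩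
    refine ⟨injective_of_mono f, fun S hS => ?_⟩
    -- `Z` is `X` with only the preimages of sets of `Y`. The identity `X ⟶ Z` is a surjective,
    -- hence epimorphic, first factor of `f`, so extremality makes it invertible and the two
    -- lattices coincide.
    let Z : Pervin.{u} :=
      { carrier := X
        sets := {S | ∃ T ∈ Y.sets, f.toFun ⁻¹' T = S}
        univ_mem := ⟨_, Y.univ_mem, rfl⟩
        empty_mem := ⟨_, Y.empty_mem, rfl⟩
        inter_mem := by
          rintro _ _ ⟨A, hA, rfl⟩ ⟨B, hB, rfl⟩
          exact ⟨_, Y.inter_mem hA hB, rfl⟩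
        union_mem := by
          rintro _ _ ⟨A, hA, rfl⟩ ⟨B, hB, rfl⟩
          exact ⟨_, Y.union_mem hA hB, rfl⟩ }
    let e : X ⟶ Z := Hom.mk (Y := Z) id <| by
      rintro _ ⟨T, hT, rfl⟩
      exact f.preimage_mem T hT
    let g : Z ⟶ Y := Hom.mk (X := Z) f.toFun fun T hT => ⟨T, hT, rfl⟩
    have := h Z e g rfl (epi_of_surjective e Function.surjective_id)
    obtain ⟨_, ⟨T, hT, rfl⟩, rfl⟩ := exists_preimage_eq_of_isIso e hS
    exact ⟨T, hT, rfl⟩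
  · rintro ⟨hf, h⟩
    refine ⟨mono_of_injective f hf, fun Z e g heg _ => isIso_of_bijective e
      ⟨Function.Injective.of_comp (f := g.toFun) ?_, surjective_of_epi e⟩ fun S hS => ?_⟩
    · rwa [← comp_toFun, heg]
    · obtain ⟨T, hT, rfl⟩ := h S hS
      exact ⟨_, g.preimage_mem T hT, by rw [← heg]; rfl⟩

/-! ### Points of complete Pervin spaces -/

/-- The Boolean algebra generated by the lattice of a Pervin space, as a sublattice. -/
abbrev booleanLattice (X : Pervin.{u}) : Sublattice (Set X) :=
  (BooleanSubalgebra.closure X.sets).toSublattice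

theorem mem_booleanLattice {X : Pervin.{u}} {S : Set X} (hS : S ∈ X.sets) : S ∈ X.booleanLattice :=
  BooleanSubalgebra.subset_closure hS

theorem compl_mem_booleanLattice {X : Pervin.{u}} {S : Set X} (hS : S ∈ X.booleanLattice) :
    Sᶜ ∈ X.booleanLattice :=
  (BooleanSubalgebra.closure X.sets).compl_mem hS

/-- The symmetric Pervin space of the prime ideals of the Boolean algebra generated by the lattice
of a Pervin space. -/
def stone (X : Pervin.{u}) : Pervin.{u} where
  carrier := {J : Set (Set X) // IsPrimeIdealOn X.booleanLattice J ∧ J ⊆ X.booleanLattice}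
  sets := {A | ∃ U ∈ X.booleanLattice, {J | U ∉ J.1} = A}
  univ_mem := ⟨⊤, (BooleanSubalgebra.closure X.sets).top_mem,
    Set.eq_univ_of_forall fun J => J.2.1.top_notMem⟩
  empty_mem := ⟨⊥, (BooleanSubalgebra.closure X.sets).bot_mem,
    Set.eq_empty_of_forall_notMem fun J h => h J.2.1.bot_mem⟩
  inter_mem := by
    rintro _ _ ⟨U, hU, rfl⟩ ⟨V, hV, rfl⟩
    refine ⟨U ⊓ V, X.booleanLattice.inf_mem hU hV, Set.ext fun J => ?_⟩
    exact (not_congr (J.2.1.inf_mem_iff hU hV)).trans not_or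
  union_mem := by
    rintro _ _ ⟨U, hU, rfl⟩ ⟨V, hV, rfl⟩
    refine ⟨U ⊔ V, X.booleanLattice.sup_mem hU hV, Set.ext fun J => ?_⟩
    exact (not_congr (J.2.1.sup_mem_iff hU hV)).trans not_and_or

theorem isSymmetric_stone (X : Pervin.{u}) : X.stone.IsSymmetric := by
  rintro _ ⟨U, hU, rfl⟩
  refine ⟨Uᶜ, compl_mem_booleanLattice hU, Set.ext fun J => ?_⟩
  exact not_congr (J.2.1.compl_mem_iff hU (compl_mem_booleanLattice hU))

theorem isT0_stone (X : Pervin.{u}) : X.stone.IsT0 := by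
  refine isT0_iff.2 fun J K h => Subtype.ext (Set.ext fun U => ?_)
  by_cases hU : U ∈ X.booleanLattice
  · exact not_iff_not.1 (h _ ⟨U, hU, rfl⟩)
  -- The requirement that points of `stone` be contained in the Boolean algebra is used here.
  · exact iff_of_false (fun h => hU (J.2.2 h)) fun h => hU (K.2.2 h)

/-- The canonical morphism to the space of prime ideals. -/
def toStone (X : Pervin.{u}) : X.symmetrization ⟶ X.stone where
  toFun x := ⟨{U : Set X | x ∉ U} ∩ X.booleanLattice,
    (isPrimeIdealOn_notMem (α := X) _ x).inter (BooleanSubalgebra.closure X.sets).bot_mem,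
    Set.inter_subset_right⟩
  preimage_mem := by
    rintro _ ⟨U, hU, rfl⟩
    refine Set.mem_of_eq_of_mem (Set.ext fun x => ?_) hU
    exact ⟨fun h => by_contra fun h' => h ⟨h', hU⟩, fun h h' => h'.1 h⟩

theorem mem_toStone {X : Pervin.{u}} {x : X} {U : Set X} (hU : U ∈ X.booleanLattice) :
    U ∈ (X.toStone.toFun x).1 ↔ x ∉ U :=
  and_iff_left hU

/-- A basic set that contains some prime ideal comes from a nonempty `U`, because `∅` lies in every
prime ideal. Any element of `U` then has its image in that basic set. -/
theorem isDense_toStone (X : Pervin.{u}) : IsDense X.toStone := by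
  refine isDense_of_forall_mem _ ?_
  rintro _ ⟨U, hU, rfl⟩ ⟨J, hJ⟩
  have hne : U.Nonempty := by
    rw [Set.nonempty_iff_ne_empty]
    rintro rfl
    exact hJ J.2.1.bot_mem
  exact hne.imp fun x hx h => h.1 hx

/-- Injectivity is the `T₀` axiom, and each `U` in the Boolean algebra is the preimage of its own
basic set. -/
theorem isExtremalMono_toStone {X : Pervin.{u}} (hX : X.IsT0) : IsExtremalMono X.toStone := by
  refine (isExtremalMono_iff _).2 ⟨fun x y h => ?_, fun U hU => ⟨_, ⟨U, hU, rfl⟩, ?_⟩⟩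
  · refine isT0_iff.1 hX x y fun s hs => ?_
    have hs := mem_booleanLattice hs
    exact not_iff_not.1 ((mem_toStone (X := X) hs).symm.trans (h ▸ mem_toStone (X := X) hs))
  · ext x
    exact (not_congr (mem_toStone hU)).trans not_not

/-- In a `T₀` complete Pervin space, the prime ideals of the generated Boolean algebra are given by
points. -/
theorem exists_point_of_isPrimeIdealOn {X : Pervin.{u}} (hX : T0Complete X) {J : Set (Set X)}
    (hJ : IsPrimeIdealOn X.booleanLattice J) : ∃ x : X, ∀ U ∈ X.booleanLattice, U ∈ J ↔ x ∉ U := by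
  have := hX.2 _ X.toStone X.isSymmetric_stone X.isT0_stone X.isDense_toStone
    (isExtremalMono_toStone hX.1)
  obtain ⟨x, hx⟩ := (bijective_of_isIso X.toStone).2 ⟨J ∩ X.booleanLattice,
    hJ.inter (BooleanSubalgebra.closure X.sets).bot_mem, Set.inter_subset_right⟩
  exact ⟨x, fun U hU => (and_iff_left hU).symm.trans
    ((iff_of_eq (congrArg (U ∈ ·.1) hx.symm)).trans (mem_toStone hU))⟩

end Pervin

/-! ### Compactness and sobriety of `T₀` complete Pervin spaces -/

open TopologicalSpace in
/-- The sets of the lattice of a `T₀` complete Pervin space are compact. -/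
theorem Pervin.isCompactElement_of_mem_sets (pit : PrimeIdealTheorem.{u}) {X : Pervin.{u}}
    (hX : T0Complete X) {U : Opens X} (hU : (U : Set X) ∈ X.sets) : IsCompactElement U := by
  rw [CompleteLattice.isCompactElement_iff_le_of_directed_sSup_le]
  intro D hne hD hUD
  have hD' : DirectedOn (· ≤ ·) ((↑) '' D : Set (Set X)) := hD.mono_comp fun _ _ h => h
  by_contra hc
  -- If no member of `D` contains `U`, a prime ideal separates `U` from the ideal generated by `D`.
  -- Its point lies in `U` and in no member of `D`.
  obtain ⟨J, hJ, hIJ, hUJ⟩ := pit.exists_isPrimeIdealOn X.booleanLattice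
    (BooleanSubalgebra.closure X.sets).bot_mem (directedIdeal _ (hne.image _) hD')
    (mem_booleanLattice hU) <| by
      rintro ⟨_, ⟨V, hV, rfl⟩, h⟩
      exact hc ⟨V, hV, h⟩
  obtain ⟨x, hx⟩ := exists_point_of_isPrimeIdealOn hX hJ
  have hxU : x ∈ (U : Set X) := not_not.1 ((not_congr (hx _ (mem_booleanLattice hU))).1 hUJ)
  obtain ⟨V, hV, hxV⟩ := Opens.mem_sSup.1 (hUD hxU)
  -- `V` is open but need not belong to the Boolean algebra, so it is replaced by a set of the
  -- lattice that contains `x` and lies in `V`.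
  obtain ⟨A, hA, hAV⟩ := PervinFrith.exists_sUnion_of_isOpen X V.isOpen
  obtain ⟨T, hT, hxT⟩ : x ∈ ⋃₀ A := hAV ▸ hxV
  have hT' := mem_booleanLattice (hA hT)
  exact (hx T hT').1 (hIJ T hT' ⟨V, ⟨V, hV, rfl⟩, hAV ▸ Set.subset_sUnion_of_mem hT⟩) hxT

open TopologicalSpace in
/-- The points of the frame of opens of a `T₀` complete Pervin space come from points of the
space. -/
theorem Pervin.bijective_localePointOfSpacePoint (pit : PrimeIdealTheorem.{u}) {X : Pervin.{u}}
    (hX : T0Complete X) : Function.Bijective (Locale.localePointOfSpacePoint X) := by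
  constructor
  · refine fun x y h => isT0_iff.1 hX.1 x y fun s hs => ?_
    exact iff_of_eq (DFunLike.congr_fun h (⟨s, isOpen_generateFrom_of_mem hs⟩ : Opens X))
  intro p
  -- This is the ideal generated by the lattice sets that fail at `p` and the complements of those
  -- that hold at `p`. It is proper because `p` is monotone, and a point realizing a prime ideal
  -- above it must agree with `p`.
  let I : Order.Ideal (Set X) :=
    { carrier := {U | ∃ s t : Opens X, (s : Set X) ∈ X.sets ∧ (t : Set X) ∈ X.sets ∧ p s ∧ ¬ p t ∧
        U ∩ s ⊆ t}
      lower' := by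
        rintro U V hVU ⟨s, t, hs, ht, hps, hpt, h⟩
        exact ⟨s, t, hs, ht, hps, hpt, (Set.inter_subset_inter_left _ hVU).trans h⟩
      nonempty' := ⟨∅, ⊤, ⊥, X.univ_mem, X.empty_mem, by simp, by simp, by simp⟩
      directed' := by
        rintro U ⟨s, t, hs, ht, hps, hpt, h⟩ V ⟨s', t', hs', ht', hps', hpt', h'⟩
        refine ⟨U ∪ V, ⟨s ⊓ s', t ⊔ t', X.inter_mem hs hs', X.union_mem ht ht', ?_, ?_, ?_⟩,
          Set.subset_union_left, Set.subset_union_right⟩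
        · rw [map_inf]
          exact ⟨hps, hps'⟩
        · rw [map_sup]
          exact not_or.2 ⟨hpt, hpt'⟩
        · rintro x ⟨hx | hx, hxs, hxs'⟩
          exacts [Or.inl (h ⟨hx, hxs⟩), Or.inr (h' ⟨hx, hxs'⟩)] }
  obtain ⟨J, hJ, hIJ, -⟩ := pit.exists_isPrimeIdealOn X.booleanLattice
    (BooleanSubalgebra.closure X.sets).bot_mem I (BooleanSubalgebra.closure X.sets).top_mem <| by
      rintro ⟨s, t, -, -, hps, hpt, h⟩
      exact hpt (OrderHomClass.mono p (show s ≤ t from fun x hx => h ⟨trivial, hx⟩) hps)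
  obtain ⟨x, hx⟩ := exists_point_of_isPrimeIdealOn hX hJ
  have key : ∀ s : Opens X, (s : Set X) ∈ X.sets → (x ∈ s ↔ p s) := by
    intro s hs
    have hs' := mem_booleanLattice hs
    constructor
    · refine fun hxs => by_contra fun hps => (hx _ hs').1 (hIJ _ hs' ?_) hxs
      exact ⟨⊤, s, X.univ_mem, hs, by simp, hps, Set.inter_subset_left⟩
    · refine fun hps => by_contra fun hxs => ?_
      refine (hx _ (compl_mem_booleanLattice hs')).1 (hIJ _ (compl_mem_booleanLattice hs') ?_) hxs
      exact ⟨s, ⊥, hs, X.empty_mem, hps, by simp, by simp⟩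
  refine ⟨x, FrameHom.ext fun U => ?_⟩
  obtain ⟨A, hA, hU⟩ : ∃ A : Set (Opens X), (∀ s ∈ A, (s : Set X) ∈ X.sets) ∧ sSup A = U :=
    (PervinFrith.opensFrith X).join_dense U
  rw [← hU, map_sSup, map_sSup]
  exact congrArg sSup (Set.image_congr fun s hs => propext (key s (hA s hs)))

/-- The unit is a continuous bijection. It is open because the image of an open `U` is the set of
points that hold at `U`, which is open by definition. -/
theorem Pervin.isSober (pit : PrimeIdealTheorem.{u}) {X : Pervin.{u}} (hX : T0Complete X) :
    X.IsSober := by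
  refine TopCat.isIso_of_bijective_of_isOpenMap _ (bijective_localePointOfSpacePoint pit hX) ?_
  refine fun U hU => ⟨⟨U, hU⟩, Set.ext fun p => ?_⟩
  obtain ⟨x, rfl⟩ := (bijective_localePointOfSpacePoint pit hX).2 p
  exact ((bijective_localePointOfSpacePoint pit hX).1.mem_set_image (s := U)).symm

theorem PervinFrith.isIso_unitHom (pit : PrimeIdealTheorem.{u}) {X : Pervin.{u}}
    (hX : T0Complete X) : IsIso (unitHom X) :=
  Pervin.isIso_of_bijective _ (Pervin.bijective_localePointOfSpacePoint pit hX) fun S hS =>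
    ⟨_, ⟨(⟨S, TopologicalSpace.isOpen_generateFrom_of_mem hS⟩ : TopologicalSpace.Opens X), hS, rfl⟩,
      rfl⟩

/-! ### Complete symmetric Frith frames -/

namespace FrithFrame

/-- The lattice of a Frith frame, as a sublattice. -/
abbrev sublattice (L : FrithFrame.{u}) : Sublattice L where
  carrier := L.lat
  supClosed' _ ha _ hb := L.sup_mem ha hb
  infClosed' _ ha _ hb := L.inf_mem ha hb

instance (L : FrithFrame.{u}) : BoundedOrder L.sublattice where
  top := ⟨⊤, L.top_mem⟩
  le_top a := le_top (a := a.1)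
  bot := ⟨⊥, L.bot_mem⟩
  bot_le a := bot_le (a := a.1)

/-- The elements of the lattice are compact elements of the frame. -/
def IsCoherent (L : FrithFrame.{u}) : Prop := ∀ s ∈ L.lat, IsCompactElement (s : L)

theorem sSup_le_self_eq (L : FrithFrame.{u}) (a : L) : sSup {s | s ∈ L.lat ∧ s ≤ a} = a := by
  refine le_antisymm (sSup_le fun s hs => hs.2) ?_
  obtain ⟨A, hA, rfl⟩ := L.join_dense a
  exact sSup_le_sSup fun s hs => ⟨hA hs, le_sSup hs⟩

theorem le_iff_forall_mem_lat {L : FrithFrame.{u}} {a b : L} :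
    a ≤ b ↔ ∀ s ∈ L.lat, s ≤ a → s ≤ b := by
  refine ⟨fun h s _ hs => hs.trans h, fun h => ?_⟩
  rw [← L.sSup_le_self_eq a]
  exact sSup_le fun s hs => h s hs.1 hs.2

theorem isIso_of_bijective {L M : FrithFrame.{u}} (h : L ⟶ M)
    (hb : Function.Bijective h.toFrameHom) (hl : h.toFrameHom '' L.lat = M.lat) : IsIso h := by
  have hle : ∀ {a b}, h.toFrameHom a ≤ h.toFrameHom b ↔ a ≤ b := by
    intro a b
    rw [← inf_eq_left, ← map_inf, hb.1.eq_iff, inf_eq_left]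
  let e : L ≃o M := ⟨Equiv.ofBijective _ hb, hle⟩
  let g : M ⟶ L := Hom.mk (L := M) (M := L) ⟨⟨⟨e.symm, map_inf e.symm⟩, map_top e.symm⟩,
    map_sSup e.symm⟩ <| by
      intro s hs
      rw [← hl] at hs
      obtain ⟨t, ht, rfl⟩ := hs
      exact Set.mem_of_eq_of_mem (e.symm_apply_apply t) ht
  exact ⟨g, hom_ext fun a => e.symm_apply_apply a, hom_ext fun a => e.apply_symm_apply a⟩

theorem injective_of_isIso {L M : FrithFrame.{u}} (h : L ⟶ M) [IsIso h] :
    Function.Injective h.toFrameHom :=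
  Function.LeftInverse.injective (g := (inv h).toFrameHom) fun a =>
    DFunLike.congr_fun (congrArg Hom.toFrameHom (IsIso.hom_inv_id h)) a

/-- A symmetric Frith frame with compact lattice elements is complete. -/
theorem IsCoherent.isCompleteOfSymmetric {L : FrithFrame.{u}} (hL : L.IsCoherent) :
    L.IsCompleteOfSymmetric := by
  intro M h hM hd he
  -- With `e` the complement of `d`, `c ≤ d` means `c ⊓ e = ⊥`, and density reflects this from the
  -- images.
  have hlat : ∀ c ∈ M.lat, ∀ d ∈ M.lat, h.toFrameHom c ≤ h.toFrameHom d → c ≤ d := by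
    intro c _ d hd' hcd
    obtain ⟨e, -, hde⟩ := hM d hd'
    rw [← hde.disjoint_right_iff, disjoint_iff]
    refine hd _ (le_bot_iff.1 ?_)
    rw [map_inf, ← map_bot h.toFrameHom, ← hde.inf_eq_bot, map_inf]
    exact inf_le_inf_right _ hcd
  -- The image of `a` is the directed join of the images of the lattice elements below `a`;
  -- compactness of the image of `c` selects one of them.
  have hle : ∀ c ∈ M.lat, ∀ a, h.toFrameHom c ≤ h.toFrameHom a → c ≤ a := by
    intro c hc a hca
    rw [← M.sSup_le_self_eq a, map_sSup] at hca
    have hdir : DirectedOn (· ≤ ·) {d | d ∈ M.lat ∧ d ≤ a} := fun d hd e he =>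
      ⟨d ⊔ e, ⟨M.sup_mem hd.1 he.1, sup_le hd.2 he.2⟩, le_sup_left, le_sup_right⟩
    obtain ⟨_, ⟨d, hd, rfl⟩, hcd⟩ :=
      (CompleteLattice.isCompactElement_iff_le_of_directed_sSup_le _ _).1
      (hL _ (h.map_mem c hc)) (h.toFrameHom '' {d | d ∈ M.lat ∧ d ≤ a})
      (⟨_, ⊥, ⟨M.bot_mem, bot_le⟩, rfl⟩)
      (hdir.mono_comp (OrderHomClass.mono h.toFrameHom)) hca
    exact (hlat c hc d hd.1 hcd).trans hd.2
  have hinj : ∀ a b, h.toFrameHom a = h.toFrameHom b → a ≤ b := fun a b hab =>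
    le_iff_forall_mem_lat.2 fun c hc hca =>
      hle c hc b (hab ▸ OrderHomClass.mono h.toFrameHom hca)
  refine isIso_of_bijective h ⟨fun a b hab => (hinj a b hab).antisymm (hinj b a hab.symm), ?_⟩ he
  intro b
  obtain ⟨A, hA, rfl⟩ := L.join_dense b
  obtain ⟨C, -, rfl⟩ := Set.subset_image_iff.1 (hA.trans he.ge)
  exact ⟨sSup C, map_sSup _ _⟩

/-! ### The frame of ideals as a test object -/

/-- The ideals of the lattice of a Frith frame form a frame. -/
@[reducible]
def idealFrame (L : FrithFrame.{u}) : Order.Frame (Order.Ideal L.sublattice) :=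
  .ofMinimalAxioms
    { inf_sSup_le_iSup_inf := fun I A => by
        -- `K` is the Heyting implication from `I` to the right-hand side. It contains every member
        -- of `A`, and is then applied to an element of `I` met with itself.
        let K : Order.Ideal L.sublattice :=
          { carrier := {a | ∀ b ∈ I, a ⊓ b ∈ ⨆ J ∈ A, I ⊓ J}
            lower' := fun a c hca ha b hb =>
              Order.Ideal.lower _ (inf_le_inf_right b hca) (ha b hb)
            nonempty' := ⟨⊥, fun b _ => by rw [bot_inf_eq]; exact Order.Ideal.bot_mem _⟩
            directed' := fun a ha c hc => ⟨a ⊔ c, fun b hb => by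
              rw [inf_sup_right]
              exact Order.Ideal.sup_mem (ha b hb) (hc b hb), le_sup_left, le_sup_right⟩ }
        have hK : sSup A ≤ K := sSup_le fun J hJ a ha b hb =>
          le_iSup₂ (f := fun J (_ : J ∈ A) => I ⊓ J) J hJ
            ⟨I.lower inf_le_right hb, J.lower inf_le_left ha⟩
        intro a ha
        have h := hK ha.2 a ha.1
        rwa [inf_idem] at h }

/-- The Frith frame of the ideals of the lattice of a Frith frame. -/
def ideals (L : FrithFrame.{u}) : FrithFrame.{u} where
  carrier := Order.Ideal L.sublattice
  frame := L.idealFrame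
  lat := Set.range Order.Ideal.principal
  top_mem := ⟨⊤, Order.Ideal.principal_top⟩
  bot_mem := ⟨⊥, Order.Ideal.principal_bot⟩
  inf_mem := by
    rintro _ _ ⟨a, rfl⟩ ⟨b, rfl⟩
    exact ⟨a ⊓ b, Order.Ideal.ext (Set.ext fun c => le_inf_iff)⟩
  sup_mem := by
    rintro _ _ ⟨a, rfl⟩ ⟨b, rfl⟩
    refine ⟨a ⊔ b, le_antisymm ?_ (sup_le ?_ ?_)⟩
    · refine Order.Ideal.principal_le_iff.2 (Order.Ideal.sup_mem ?_ ?_)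
      · exact Order.Ideal.principal_le_iff.1 (le_sup_left (α := Order.Ideal L.sublattice))
      · exact Order.Ideal.principal_le_iff.1 (le_sup_right (α := Order.Ideal L.sublattice))
    · exact Order.Ideal.principal_le_iff.2 (le_sup_left (a := a))
    · exact Order.Ideal.principal_le_iff.2 (le_sup_right (a := a))
  join_dense I := ⟨Order.Ideal.principal '' I, Set.image_subset_range _ _,
    le_antisymm
      (sSup_le (α := Order.Ideal L.sublattice) <| by
        rintro _ ⟨a, ha, rfl⟩
        exact Order.Ideal.principal_le_iff.2 ha)
      fun _ ha => Order.Ideal.principal_le_iff.1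
        (le_sSup (α := Order.Ideal L.sublattice) (Set.mem_image_of_mem _ ha))⟩

/-- As a left adjoint, the join map on ideals preserves all joins. -/
theorem gc_idealSup (L : FrithFrame.{u}) :
    GaloisConnection (fun I : Order.Ideal L.sublattice => sSup ((↑) '' (I : Set L.sublattice)))
      (fun a : L => (⟨⟨{s | s.1 ≤ a}, fun _ _ h h' => le_trans (α := L) h h'⟩, ⟨⊥, bot_le (α := L)⟩,
        fun s hs t ht => ⟨s ⊔ t, sup_le (α := L) hs ht, le_sup_left, le_sup_right⟩⟩ :
          Order.Ideal L.sublattice)) := by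
  intro I a
  rw [sSup_le_iff, Set.forall_mem_image]
  rfl

theorem idealSup_principal (L : FrithFrame.{u}) (s : L.sublattice) :
    sSup ((↑) '' (Order.Ideal.principal s : Set L.sublattice)) = s.1 := by
  refine le_antisymm (sSup_le ?_) (le_sSup ⟨s, le_rfl (a := s), rfl⟩)
  rintro _ ⟨t, ht, rfl⟩
  exact ht

/-- The morphism that sends an ideal of the lattice to its join. -/
def idealSup (L : FrithFrame.{u}) : L.ideals ⟶ L where
  toFrameHom :=
    { toFun := fun I : Order.Ideal L.sublattice => sSup ((↑) '' (I : Set L.sublattice))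
      map_inf' := fun I J => by
        refine le_antisymm (le_inf (L.gc_idealSup.monotone_l inf_le_left)
          (L.gc_idealSup.monotone_l inf_le_right)) ?_
        rw [sSup_inf_sSup]
        refine iSup₂_le ?_
        rintro ⟨_, _⟩ ⟨⟨a, ha, rfl⟩, ⟨b, hb, rfl⟩⟩
        exact le_sSup ⟨a ⊓ b, ⟨I.lower inf_le_left ha, J.lower inf_le_right hb⟩, rfl⟩
      map_top' := top_le_iff.1 (le_sSup ⟨⊤, trivial, rfl⟩)
      map_sSup' := fun _ => L.gc_idealSup.l_sSup.trans sSup_image.symm }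
  map_mem := by
    rintro _ ⟨s, rfl⟩
    exact Set.mem_of_eq_of_mem (L.idealSup_principal s) s.2

/-- An ideal with join `⊥` has `⊥` as its only element. -/
theorem isDense_idealSup (L : FrithFrame.{u}) : IsDense L.idealSup := by
  intro I hI
  refine eq_bot_iff.2 fun a ha => ?_
  have : a = ⊥ := Subtype.ext (eq_bot_iff.2 (hI ▸ le_sSup (Set.mem_image_of_mem _ ha)))
  exact this ▸ Order.Ideal.bot_mem (P := L.sublattice) ⊥

theorem isExtremalEpi_idealSup (L : FrithFrame.{u}) : IsExtremalEpi L.idealSup := by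
  ext s
  constructor
  · rintro ⟨_, ⟨s, rfl⟩, rfl⟩
    exact Set.mem_of_eq_of_mem (L.idealSup_principal s) s.2
  · exact fun hs => ⟨_, ⟨⟨s, hs⟩, rfl⟩, L.idealSup_principal ⟨s, hs⟩⟩

/-- The principal ideals of complementary elements are complementary. -/
theorem IsSymmetric.ideals {L : FrithFrame.{u}} (hL : L.IsSymmetric) : L.ideals.IsSymmetric := by
  rintro _ ⟨⟨s, hs⟩, rfl⟩
  obtain ⟨t, ht, hst⟩ := hL s hs
  refine ⟨_, ⟨⟨t, ht⟩, rfl⟩, disjoint_iff_inf_le.2 ?_, codisjoint_iff_le_sup.2 ?_⟩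
  · rintro a ⟨ha, ha'⟩
    have : a = ⊥ := Subtype.ext (eq_bot_iff.2 (hst.inf_eq_bot ▸ le_inf (α := L) ha ha'))
    exact this ▸ Order.Ideal.bot_mem (P := L.sublattice) ⊥
  · refine (Order.Ideal.principal_top (P := L.sublattice)).ge.trans
      (Order.Ideal.principal_le_iff.2 ?_)
    have : (⊤ : L.sublattice) = ⟨s, hs⟩ ⊔ ⟨t, ht⟩ := Subtype.ext hst.sup_eq_top.symm
    rw [this]
    exact Order.Ideal.sup_mem
      (Order.Ideal.principal_le_iff.1 (le_sup_left (α := Order.Ideal L.sublattice)))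
      (Order.Ideal.principal_le_iff.1 (le_sup_right (α := Order.Ideal L.sublattice)))

/-- The lattice elements of a complete symmetric Frith frame are compact. -/
theorem IsCompleteOfSymmetric.isCoherent {L : FrithFrame.{u}} (hL : L.IsCompleteOfSymmetric)
    (hs : L.IsSymmetric) : L.IsCoherent := by
  intro s hsL
  rw [CompleteLattice.isCompactElement_iff_le_of_directed_sSup_le]
  intro D hne hD hsD
  have := hL _ L.idealSup hs.ideals L.isDense_idealSup L.isExtremalEpi_idealSup
  let J : Order.Ideal L.sublattice :=
    { carrier := {a | a.1 ∈ directedIdeal D hne hD}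
      lower' := fun a b hab ha => (directedIdeal D hne hD).lower (show b.1 ≤ a.1 from hab) ha
      nonempty' := ⟨⊥, (directedIdeal D hne hD).bot_mem⟩
      directed' := fun a ha b hb => ⟨a ⊔ b, Order.Ideal.sup_mem (s := directedIdeal D hne hD) ha hb,
        le_sup_left, le_sup_right⟩ }
  have hJ : s ≤ L.idealSup.toFrameHom J := by
    refine hsD.trans (sSup_le fun d hd => ?_)
    rw [← L.sSup_le_self_eq d]
    exact sSup_le_sSup fun t ht => ⟨⟨t, ht.1⟩, ⟨d, hd, ht.2⟩, rfl⟩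
  let I : Order.Ideal L.sublattice := .principal ⟨s, hsL⟩
  -- Since `s` is below the join of `J`, cutting the principal ideal of `s` down to `J` does not
  -- change its join. Completeness makes the join map injective, so `s` itself lies in `J`.
  have h : L.idealSup.toFrameHom (I ⊓ J : Order.Ideal L.sublattice) = L.idealSup.toFrameHom I := by
    refine (L.idealSup.toFrameHom.map_inf' I J).trans (inf_eq_left.2 ?_)
    exact (L.idealSup_principal ⟨s, hsL⟩).le.trans hJ
  have hIJ : I ⊓ J = I := injective_of_isIso L.idealSup h
  exact (inf_eq_left.1 hIJ) (le_refl (⟨s, hsL⟩ : L.sublattice))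

end FrithFrame

/-! ### Points of coherent Frith frames -/

namespace FrithFrame

open FrameCongruence

/-- A prime ideal of the lattice of a coherent Frith frame is the set of lattice elements that do
not hold at some point. -/
theorem IsCoherent.exists_point {L : FrithFrame.{u}} (hL : L.IsCoherent) {J : Set L}
    (hJ : IsPrimeIdealOn L.sublattice J) : ∃ p : FrameHom L Prop, ∀ s ∈ L.lat, p s ↔ s ∉ J := by
  -- The point holds at `a` when some lattice element below `a` escapes `J`. Primeness gives finite
  -- meets; compactness is needed only for joins.
  refine ⟨⟨⟨⟨fun a => ∃ s ∈ L.lat, s ≤ a ∧ s ∉ J, fun a b => propext ?_⟩, eq_true ?_⟩,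
    fun A => propext ?_⟩, fun s hs => ?_⟩
  · constructor
    · rintro ⟨s, hs, hsab, hsJ⟩
      exact ⟨⟨s, hs, hsab.trans inf_le_left, hsJ⟩, ⟨s, hs, hsab.trans inf_le_right, hsJ⟩⟩
    · rintro ⟨⟨s, hs, hsa, hsJ⟩, ⟨t, ht, htb, htJ⟩⟩
      exact ⟨s ⊓ t, L.inf_mem hs ht, inf_le_inf hsa htb,
        fun h => ((hJ.inf_mem_iff hs ht).1 h).elim hsJ htJ⟩
  · exact ⟨⊤, L.top_mem, le_rfl, hJ.top_notMem⟩
  · simp only [sSup_image, iSup_Prop_eq]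
    constructor
    · rintro ⟨s, hs, hsA, hsJ⟩
      by_contra! h
      -- If no member of `A` has a lattice element outside `J` below it, then `sSup A` lies below
      -- the directed join of the lattice elements in `J`. By compactness `s` is below one of these,
      -- so `s ∈ J`.
      let D : Set L := {t | t ∈ L.lat ∧ t ∈ J}
      have hD : DirectedOn (· ≤ ·) D := fun t ht t' ht' =>
        ⟨t ⊔ t', ⟨L.sup_mem ht.1 ht'.1, (hJ.sup_mem_iff ht.1 ht'.1).2 ⟨ht.2, ht'.2⟩⟩,
          le_sup_left, le_sup_right⟩
      have hsD : s ≤ sSup D := by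
        refine hsA.trans (sSup_le fun a ha => ?_)
        rw [← L.sSup_le_self_eq a]
        refine sSup_le_sSup fun t ht => ⟨ht.1, h a ha t ht.1 ht.2⟩
      obtain ⟨t, ht, hst⟩ := (CompleteLattice.isCompactElement_iff_le_of_directed_sSup_le _ _).1
        (hL s hs) D ⟨⊥, L.bot_mem, hJ.bot_mem⟩ hD hsD
      exact hsJ (hJ.mem_of_le hs ht.1 hst ht.2)
    · rintro ⟨a, ha, s, hs, hsa, hsJ⟩
      exact ⟨s, hs, hsa.trans (le_sSup ha), hsJ⟩
  · exact ⟨fun ⟨t, ht, hts, htJ⟩ h => htJ (hJ.mem_of_le ht hs hts h), fun h => ⟨s, hs, le_rfl, h⟩⟩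

/-- Points separate the elements of a coherent Frith frame. -/
theorem IsCoherent.exists_point_of_not_le (pit : PrimeIdealTheorem.{u}) {L : FrithFrame.{u}}
    (hL : L.IsCoherent) {a b : L} (hab : ¬ a ≤ b) : ∃ p : FrameHom L Prop, p a ∧ ¬ p b := by
  rw [le_iff_forall_mem_lat] at hab
  push Not at hab
  obtain ⟨s, hs, hsa, hsb⟩ := hab
  obtain ⟨J, hJ, hIJ, hsJ⟩ := pit.exists_isPrimeIdealOn L.sublattice L.bot_mem
    (Order.Ideal.principal b) hs hsb
  obtain ⟨p, hp⟩ := hL.exists_point hJ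
  refine ⟨p, OrderHomClass.mono p hsa ((hp s hs).2 hsJ), fun hpb => ?_⟩
  -- The ideal below `b` meets the lattice inside `J`, so `p` fails at every lattice element of
  -- which `b` is the join.
  obtain ⟨A, hA, rfl⟩ := L.join_dense b
  rw [map_sSup, sSup_image] at hpb
  simp only [iSup_Prop_eq] at hpb
  obtain ⟨t, ht, hpt⟩ := hpb
  exact (hp t (hA ht)).1 hpt (hIJ t (hA ht) (le_sSup ht))

/-! ### Coherence of the symmetric reflection -/

theorem symFrame_val_bot (L : FrithFrame.{u}) : (⊥ : L.SymFrame).val = ⊥ :=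
  le_bot_iff.1 ((Subframe.val_le _).1 (bot_le (a := (⟨sSup ∅, .sSup ∅ (by simp)⟩ : L.SymFrame)))
    |>.trans sSup_empty.le)

theorem symFrame_val_sup (L : FrithFrame.{u}) (a b : L.SymFrame) :
    (a ⊔ b).val = a.val ⊔ b.val := by
  rw [← sSup_pair, Subframe.val_sSup, Set.image_pair, sSup_pair]

theorem isCompl_symClosed_symOpen (L : FrithFrame.{u}) (s : L.lat) :
    IsCompl (L.symClosed s) (L.symOpen s) := by
  refine ⟨disjoint_iff.2 (Subframe.ext ?_), codisjoint_iff.2 (Subframe.ext ?_)⟩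
  · exact (isCompl_closed_opn s.1).inf_eq_bot.trans L.symFrame_val_bot.symm
  · exact (L.symFrame_val_sup _ _).trans (isCompl_closed_opn s.1).sup_eq_top

/-- By distributivity and the De Morgan laws, the elements with a complement in the lattice form a
sublattice, and it contains the generators. -/
theorem isSymmetric_symmetrization (L : FrithFrame.{u}) : L.symmetrization.IsSymmetric := by
  intro c hc
  refine latticeClosure_min (t := {c : L.SymFrame | ∃ d ∈ L.symLattice, IsCompl c d}) ?_ ⟨?_, ?_⟩ hc
  · rintro _ (⟨s, hs, rfl⟩ | ⟨s, rfl⟩)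
    · exact ⟨_, L.symOpen_mem ⟨s, hs⟩, L.isCompl_symClosed_symOpen ⟨s, hs⟩⟩
    · exact ⟨_, L.symClosed_mem s.2, (L.isCompl_symClosed_symOpen s).symm⟩
  · rintro a ⟨a', ha', haa'⟩ b ⟨b', hb', hbb'⟩
    exact ⟨a' ⊓ b', isSublattice_latticeClosure.infClosed ha' hb', haa'.sup_inf hbb'⟩
  · rintro a ⟨a', ha', haa'⟩ b ⟨b', hb', hbb'⟩
    exact ⟨a' ⊔ b', isSublattice_latticeClosure.supClosed ha' hb', haa'.inf_sup hbb'⟩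

/-- The congruence of the pairs of elements that are not separated by a point. -/
def _root_.FrameCongruence.ker {L : Type u} [Order.Frame L] (p : FrameHom L Prop) :
    FrameCongruence L where
  rel x y := p x = p y
  refl' _ := rfl
  symm' h := h.symm
  trans' h₁ h₂ := h₁.trans h₂
  inf' h₁ h₂ := by rw [map_inf, map_inf, h₁, h₂]
  iSup' h := by simp only [map_iSup, h]

theorem symClosed_sup (L : FrithFrame.{u}) (a b : L) :
    L.symClosed (a ⊔ b) = L.symClosed a ⊔ L.symClosed b := by
  rw [← sSup_pair, symClosed_sSup, Set.image_pair, sSup_pair]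

theorem symClosed_le_symClosed {L : FrithFrame.{u}} {a b : L} :
    L.symClosed a ≤ L.symClosed b ↔ a ≤ b := by
  refine (closed_le_iff a (closed b)).trans ?_
  change b ⊔ a = b ⊔ ⊥ ↔ _
  rw [sup_bot_eq, sup_eq_left]

theorem symClosed_inf (L : FrithFrame.{u}) (a b : L) :
    L.symClosed (a ⊓ b) = L.symClosed a ⊓ L.symClosed b := by
  refine le_antisymm (le_inf (symClosed_le_symClosed.2 inf_le_left)
    (symClosed_le_symClosed.2 inf_le_right)) fun x y h => ?_
  have ha : a ⊔ x = a ⊔ y := (inf_le_left : closed a ⊓ closed b ≤ _) x y h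
  have hb : b ⊔ x = b ⊔ y := (inf_le_right : closed a ⊓ closed b ≤ _) x y h
  change a ⊓ b ⊔ x = a ⊓ b ⊔ y
  rw [sup_inf_right, sup_inf_right, ha, hb]

/-- The sublattice generated by the congruences `∇ s` and their complements. -/
abbrev symSublattice (L : FrithFrame.{u}) : Sublattice L.SymFrame where
  carrier := L.symLattice
  supClosed' := isSublattice_latticeClosure.supClosed
  infClosed' := isSublattice_latticeClosure.infClosed

theorem symOpen_mem_iff {L : FrithFrame.{u}} {J : Set L.SymFrame}
    (hJ : IsPrimeIdealOn L.symSublattice J) (s : L.lat) :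
    L.symOpen s ∈ J ↔ L.symClosed s ∉ J := by
  have h := L.isCompl_symClosed_symOpen s
  have hc := L.symClosed_mem s.2
  have ho := L.symOpen_mem s
  constructor
  · intro hoJ hcJ
    have h' := (hJ.sup_mem_iff hc ho).2 ⟨hcJ, hoJ⟩
    rw [h.sup_eq_top] at h'
    exact hJ.top_notMem h'
  · refine ((hJ.inf_mem_iff hc ho).1 ?_).resolve_left
    rw [h.inf_eq_bot]
    exact hJ.bot_mem

theorem isPrimeIdealOn_preimage_symClosed {L : FrithFrame.{u}} {J : Set L.SymFrame}
    (hJ : IsPrimeIdealOn L.symSublattice J) : IsPrimeIdealOn L.sublattice (L.symClosed ⁻¹' J) where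
  bot_mem := by
    rw [Set.mem_preimage, symClosed_bot]
    exact hJ.bot_mem
  top_notMem := fun h => hJ.top_notMem (Set.mem_of_eq_of_mem L.symClosed_top.symm h)
  sup_mem_iff := fun {a b} ha hb => by
    rw [Set.mem_preimage, symClosed_sup]
    exact hJ.sup_mem_iff (L.symClosed_mem ha) (L.symClosed_mem hb)
  inf_mem_iff := fun {a b} ha hb => by
    rw [Set.mem_preimage, symClosed_inf]
    exact hJ.inf_mem_iff (L.symClosed_mem ha) (L.symClosed_mem hb)

/-- The pullback of `J` along `∇` yields a point `p` of `L`, and `θ` is its kernel. It contains `∇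
s` when `p` fails at `s` and `Δ s` when `p` holds, so it is codisjoint from the complementary
generator; induction on lattice terms does the rest. Thus `θ` plays the role of the point of `C_S L`
at which `J` fails. -/
theorem IsCoherent.exists_frameCongruence {L : FrithFrame.{u}} (hL : L.IsCoherent)
    {J : Set L.SymFrame} (hJ : IsPrimeIdealOn L.symSublattice J) :
    ∃ θ : FrameCongruence L, θ ≠ ⊤ ∧
      ∀ d ∈ L.symLattice, (d ∈ J ∧ d.val ≤ θ) ∨ (d ∉ J ∧ Codisjoint d.val θ) := by
  obtain ⟨p, hp⟩ := hL.exists_point (isPrimeIdealOn_preimage_symClosed hJ)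
  refine ⟨ker p, fun h => ?_, fun d hd => ?_⟩
  · have h' : p ⊤ = p ⊥ := h.ge ⊤ ⊥
      ((closed_le_iff ⊤ ⊤).1 le_top)
    rw [map_top, map_bot] at h'
    exact top_ne_bot h'
  have hclosed : ∀ s ∈ L.lat, L.symClosed s ∈ J → closed s ≤ ker p := by
    intro s hs hsJ
    rw [closed_le_iff]
    change p s = p ⊥
    rw [map_bot]
    exact eq_false fun h => (hp s hs).1 h hsJ
  have hopn : ∀ s ∈ L.lat, L.symClosed s ∉ J → opn s ≤ ker p := by
    intro s hs hsJ
    rw [opn_le_iff]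
    change p s = p ⊤
    rw [map_top]
    exact eq_true ((hp s hs).2 hsJ)
  induction hd using latticeClosure_sup_inf_induction with
  | mem d hd =>
    rcases hd with ⟨s, hs, rfl⟩ | ⟨s, rfl⟩
    · by_cases hsJ : L.symClosed s ∈ J
      · exact Or.inl ⟨hsJ, hclosed s hs hsJ⟩
      · exact Or.inr ⟨hsJ, (isCompl_closed_opn s).codisjoint.mono_right (hopn s hs hsJ)⟩
    · rw [symOpen_mem_iff hJ, not_not]
      by_cases hsJ : L.symClosed s ∈ J
      · exact Or.inr ⟨hsJ,
          (isCompl_closed_opn s.1).codisjoint.symm.mono_right (hclosed s s.2 hsJ)⟩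
      · exact Or.inl ⟨hsJ, hopn s s.2 hsJ⟩
  | sup a ha b hb iha ihb =>
    rw [hJ.sup_mem_iff ha hb, symFrame_val_sup]
    rcases iha with ⟨haJ, ha'⟩ | ⟨haJ, ha'⟩
    · rcases ihb with ⟨hbJ, hb'⟩ | ⟨hbJ, hb'⟩
      · exact Or.inl ⟨⟨haJ, hbJ⟩, sup_le ha' hb'⟩
      · exact Or.inr ⟨fun h => hbJ h.2, hb'.mono_left le_sup_right⟩
    · exact Or.inr ⟨fun h => haJ h.1, ha'.mono_left le_sup_left⟩
  | inf a ha b hb iha ihb =>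
    rw [hJ.inf_mem_iff ha hb, Subframe.val_inf]
    rcases iha with ⟨haJ, ha'⟩ | ⟨haJ, ha'⟩
    · exact Or.inl ⟨Or.inl haJ, inf_le_left.trans ha'⟩
    · rcases ihb with ⟨hbJ, hb'⟩ | ⟨hbJ, hb'⟩
      · exact Or.inl ⟨Or.inr hbJ, inf_le_right.trans hb'⟩
      · exact Or.inr ⟨fun h => h.elim haJ hbJ, ha'.inf_left hb'⟩

/-- If `c` lies below a directed join but below none of its members, a prime ideal contains
everything in the lattice below a member and omits `c`. The associated `θ` then contains the whole
join, hence `c`, while being codisjoint from `c`, which forces `θ = ⊤`. -/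
theorem IsCoherent.symmetrization (pit : PrimeIdealTheorem.{u}) {L : FrithFrame.{u}}
    (hL : L.IsCoherent) : L.symmetrization.IsCoherent := by
  suffices h : ∀ c ∈ L.symLattice, IsCompactElement c from h
  intro c hc
  rw [CompleteLattice.isCompactElement_iff_le_of_directed_sSup_le]
  intro D hne hD hcD
  by_contra hcD'
  obtain ⟨J, hJ, hIJ, hcJ⟩ := pit.exists_isPrimeIdealOn L.symSublattice
    L.symmetrization.bot_mem (directedIdeal D hne hD) hc hcD'
  obtain ⟨θ, hθ, hJθ⟩ := hL.exists_frameCongruence hJ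
  obtain ⟨h, -⟩ | ⟨-, h⟩ := hJθ c hc
  · exact hcJ h
  refine hθ (h.symm.eq_top_of_le (le_trans hcD ?_))
  rw [Subframe.val_sSup]
  refine sSup_le ?_
  rintro _ ⟨d, hd, rfl⟩
  -- Members of `D` need not lie in the lattice, so each is split into the lattice elements below
  -- it, which do lie in `J`.
  have hd' : sSup {t | t ∈ L.symLattice ∧ t ≤ d} = d := L.symmetrization.sSup_le_self_eq d
  rw [← hd', Subframe.val_sSup]
  refine sSup_le ?_
  rintro _ ⟨t, ⟨ht, htd⟩, rfl⟩
  exact ((hJθ t ht).resolve_right fun h => h.1 (hIJ t ht ⟨d, hd, htd⟩)).2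

/-- The map `∇` preserves joins and reflects the order, so compactness of `∇ s` pulls back to `s`.
-/
theorem IsCoherent.of_symmetrization {L : FrithFrame.{u}} (hL : L.symmetrization.IsCoherent) :
    L.IsCoherent := by
  intro s hs
  rw [CompleteLattice.isCompactElement_iff_le_of_directed_sSup_le]
  intro D hne hD hsD
  have hc : IsCompactElement (L.symClosed s) := hL _ (L.symClosed_mem hs)
  rw [CompleteLattice.isCompactElement_iff_le_of_directed_sSup_le] at hc
  obtain ⟨_, ⟨d, hd, rfl⟩, hsd⟩ := hc _ (hne.image L.symClosed)
    (hD.mono_comp fun _ _ h => symClosed_le_symClosed.2 h)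
    (L.symClosed_sSup D ▸ symClosed_le_symClosed.2 hsD)
  exact ⟨d, hd, symClosed_le_symClosed.1 hsd⟩

/-- A Frith frame is complete if and only if its lattice elements are compact. -/
theorem isComplete_iff_isCoherent (pit : PrimeIdealTheorem.{u}) {L : FrithFrame.{u}} :
    L.IsComplete ↔ L.IsCoherent :=
  ⟨fun h => .of_symmetrization (h.isCoherent L.isSymmetric_symmetrization),
    fun h => (h.symmetrization pit).isCompleteOfSymmetric⟩

end FrithFrame

/-! ### Completeness of the space of points -/

open TopologicalSpace in
-- By symmetry `T \ T'` is open, so if it is nonempty it meets the dense image.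
theorem Pervin.IsDense.preimage_subset_iff {X Y : Pervin.{u}} {m : X ⟶ Y} (hm : IsDense m)
    (hY : Y.IsSymmetric) {T T' : Set Y} (hT : T ∈ Y.sets) (hT' : T' ∈ Y.sets) :
    m.toFun ⁻¹' T ⊆ m.toFun ⁻¹' T' ↔ T ⊆ T' := by
  refine ⟨fun h y hy => by_contra fun hy' => ?_, fun h => Set.preimage_mono h⟩
  obtain ⟨_, ⟨hxT, hxT'⟩, x, rfl⟩ := dense_iff_inter_open.1 hm _
    (isOpen_generateFrom_of_mem (Y.inter_mem hT (hY T' hT'))) ⟨y, hy, hy'⟩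
  exact hxT' (h hxT)

/-- Along a dense extremal monomorphism of symmetric Pervin spaces, the points of the codomain give
prime ideals of the lattice of the domain. -/
theorem Pervin.exists_isPrimeIdealOn_of_isDense {X Y : Pervin.{u}} {m : X.symmetrization ⟶ Y}
    (hY : Y.IsSymmetric) (hd : IsDense m) (he : IsExtremalMono m) (y : Y) :
    ∃ J : Set (Set X), IsPrimeIdealOn X.booleanLattice J ∧
      ∀ T ∈ Y.sets, m.toFun ⁻¹' T ∈ J ↔ y ∉ T := by
  -- A set of the domain may be a preimage in several ways; density makes the condition on `y`
  -- independent of the choice.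
  have hJ : ∀ T ∈ Y.sets, (∃ T' ∈ Y.sets, m.toFun ⁻¹' T' = m.toFun ⁻¹' T ∧ y ∉ T') ↔ y ∉ T := by
    refine fun T hT => ⟨?_, fun hy => ⟨T, hT, rfl, hy⟩⟩
    rintro ⟨T', hT', h, hy⟩ hyT
    exact hy ((hd.preimage_subset_iff hY hT hT').1 h.ge hyT)
  refine ⟨{A | ∃ T ∈ Y.sets, m.toFun ⁻¹' T = A ∧ y ∉ T}, ⟨?_, ?_, ?_, ?_⟩, hJ⟩
  · exact ⟨∅, Y.empty_mem, rfl, id⟩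
  · exact fun h => (hJ _ Y.univ_mem).1 h trivial
  · intro A B hA hB
    obtain ⟨T, hT, rfl⟩ := ((isExtremalMono_iff m).1 he).2 A hA
    obtain ⟨T', hT', rfl⟩ := ((isExtremalMono_iff m).1 he).2 B hB
    exact (hJ _ (Y.union_mem hT hT')).trans (not_or.trans (and_congr (hJ T hT) (hJ T' hT')).symm)
  · intro A B hA hB
    obtain ⟨T, hT, rfl⟩ := ((isExtremalMono_iff m).1 he).2 A hA
    obtain ⟨T', hT', rfl⟩ := ((isExtremalMono_iff m).1 he).2 B hB
    exact (hJ _ (Y.inter_mem hT hT')).trans (not_and_or.trans (or_congr (hJ T hT) (hJ T' hT')).symm)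

namespace PervinFrith

open FrithFrame

theorem frameHom_ext_of_lat {L : FrithFrame.{u}} {p q : FrameHom L Prop}
    (h : ∀ s ∈ L.lat, p s ↔ q s) : p = q := by
  refine FrameHom.ext fun a => ?_
  obtain ⟨A, hA, rfl⟩ := L.join_dense a
  rw [map_sSup, map_sSup]
  exact congrArg sSup (Set.image_congr fun s hs => propext (h s (hA hs)))

theorem isT0_ptPervin (L : FrithFrame.{u}) : (ptPervin L).IsT0 :=
  Pervin.isT0_iff.2 fun _ _ h => frameHom_ext_of_lat fun s hs => h _ ⟨s, hs, rfl⟩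

/-- A point `y` of a dense extension leaves a prime ideal on the Boolean algebra of sets of points,
hence one on the lattice of `L`. Compactness turns the latter into a point `p` of `L`, and the `T₀`
axiom identifies `y` with the image of `p`. -/
theorem isComplete_ptPervin {L : FrithFrame.{u}} (hL : L.IsCoherent) :
    (ptPervin L).IsComplete := by
  intro Y m hY hT0 hd he
  obtain ⟨hinj, hpre⟩ := (Pervin.isExtremalMono_iff m).1 he
  refine Pervin.isIso_of_bijective m ⟨hinj, fun y => ?_⟩ hpre
  obtain ⟨J, hJ, hJy⟩ := Pervin.exists_isPrimeIdealOn_of_isDense hY hd he y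
  have hmem : ∀ s ∈ L.lat, pointsAt L s ∈ (ptPervin L).booleanLattice := fun s hs =>
    Pervin.mem_booleanLattice ⟨s, hs, rfl⟩
  have hJ' : IsPrimeIdealOn L.sublattice (pointsAt L ⁻¹' J) :=
    { bot_mem := by
        have h : pointsAt L ⊥ = ⊥ :=
          Set.ext fun p : FrameHom L Prop => iff_of_eq (map_bot p)
        rw [Set.mem_preimage, h]
        exact hJ.bot_mem
      top_notMem := by
        have h : pointsAt L ⊤ = ⊤ :=
          Set.ext fun p : FrameHom L Prop => iff_of_eq (map_top p)
        rw [Set.mem_preimage, h]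
        exact hJ.top_notMem
      sup_mem_iff := fun {a b} ha hb => by
        have h : pointsAt L (a ⊔ b) = pointsAt L a ⊔ pointsAt L b :=
          Set.ext fun p : FrameHom L Prop => iff_of_eq (map_sup p a b)
        rw [Set.mem_preimage, h]
        exact hJ.sup_mem_iff (hmem a ha) (hmem b hb)
      inf_mem_iff := fun {a b} ha hb => by
        have h : pointsAt L (a ⊓ b) = pointsAt L a ⊓ pointsAt L b :=
          Set.ext fun p : FrameHom L Prop => iff_of_eq (map_inf p a b)
        rw [Set.mem_preimage, h]
        exact hJ.inf_mem_iff (hmem a ha) (hmem b hb) }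
  obtain ⟨p, hp⟩ := hL.exists_point hJ'
  -- The choice of `p` gives this on generators only; primeness of `J` carries it through joins and
  -- complements.
  have key : ∀ A ∈ (ptPervin L).booleanLattice, (show ptPervin L from p) ∈ A ↔ A ∉ J := by
    intro A hA
    induction hA using BooleanSubalgebra.closure_bot_sup_induction with
    | mem A hA =>
      obtain ⟨s, hs, rfl⟩ := hA
      exact hp s hs
    | bot => exact iff_of_false id fun h => h hJ.bot_mem
    | sup A hA B hB ihA ihB =>
      exact (or_congr ihA ihB).trans (not_and_or.symm.trans (not_congr (hJ.sup_mem_iff hA hB)).symm)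
    | compl A hA ih =>
      exact (not_congr ih).trans
        (not_congr (hJ.compl_mem_iff hA (Pervin.compl_mem_booleanLattice hA))).symm
  refine ⟨p, Pervin.isT0_iff.1 hT0 _ _ fun T hT => ?_⟩
  exact (key _ (m.preimage_mem T hT)).trans ((not_congr (hJy T hT)).trans not_not)

/-! ### The unit and the counit -/

/-- Injectivity is the separation of elements by points. Surjectivity holds because the open sets
are unions of the generating sets. -/
theorem bijective_pointsFrameHom (pit : PrimeIdealTheorem.{u}) {L : FrithFrame.{u}}
    (hL : L.IsCoherent) : Function.Bijective (pointsFrameHom L) := by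
  have hle : ∀ a b, pointsFrameHom L a = pointsFrameHom L b → a ≤ b := by
    intro a b h
    by_contra hab
    obtain ⟨p, hpa, hpb⟩ := hL.exists_point_of_not_le pit hab
    exact hpb (h.le hpa)
  refine ⟨fun a b h => (hle a b h).antisymm (hle b a h.symm), fun U => ?_⟩
  obtain ⟨A, hA, hU⟩ := exists_sUnion_of_isOpen (ptPervin L) U.isOpen
  refine ⟨sSup {s | pointsAt L s ∈ A}, TopologicalSpace.Opens.ext ?_⟩
  refine (pointsAt_sSup L _).trans (Eq.trans ?_ hU)
  ext p
  simp only [Set.mem_iUnion, Set.mem_sUnion]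
  constructor
  · rintro ⟨s, hs, hp⟩
    exact ⟨_, hs, hp⟩
  · rintro ⟨T, hT, hp⟩
    obtain ⟨s, -, rfl⟩ := hA hT
    exact ⟨s, hT, hp⟩

theorem isIso_counitHom (pit : PrimeIdealTheorem.{u}) {L : FrithFrame.{u}} (hL : L.IsCoherent) :
    IsIso (counitHom L) := by
  refine FrithFrame.isIso_of_bijective _ (bijective_pointsFrameHom pit hL) ?_
  ext U
  constructor
  · rintro ⟨s, hs, rfl⟩
    exact ⟨s, hs, rfl⟩
  · rintro ⟨s, hs, h⟩
    exact ⟨s, hs, TopologicalSpace.Opens.ext h⟩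

theorem isSpatial_of_isCoherent (pit : PrimeIdealTheorem.{u}) {L : FrithFrame.{u}}
    (hL : L.IsCoherent) : L.IsSpatial := by
  let f := Locale.counitAppCont (Locale.of L)
  have hf : Function.Bijective f := by
    have hle : ∀ a b, f a = f b → a ≤ b := by
      intro a b h
      by_contra hab
      obtain ⟨p, hpa, hpb⟩ := hL.exists_point_of_not_le pit hab
      exact hpb (h.le (show p ∈ f a from hpa))
    refine ⟨fun a b h => (hle a b h).antisymm (hle b a h.symm), ?_⟩
    -- The open sets of the classical space of points are by definition those of the form `{p | p
    -- u}`.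
    rintro ⟨_, u, rfl⟩
    exact ⟨u, rfl⟩
  have hfle : ∀ {a b}, f a ≤ f b ↔ a ≤ b := by
    intro a b
    rw [← inf_eq_left, ← map_inf, hf.1.eq_iff, inf_eq_left]
  have : IsIso (Frm.ofHom f) :=
    (Frm.Iso.mk (α := Frm.of L) (β := Frm.of (TopologicalSpace.Opens (Locale.PT L)))
      ⟨Equiv.ofBijective f hf, hfle⟩).isIso_hom
  exact inferInstanceAs (IsIso (Frm.ofHom f).op)

theorem isCoherent_opensFrith (pit : PrimeIdealTheorem.{u}) {X : Pervin.{u}} (hX : T0Complete X) :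
    (opensFrith X).IsCoherent :=
  fun _ hU => Pervin.isCompactElement_of_mem_sets pit hX hU

end PervinFrith

/-! ### The restricted dual equivalence -/

theorem theorem4 (pit : PrimeIdealTheorem.{u}) :
    ∃ (hΩ : ∀ X : Pervin.{u}, T0Complete X → CompleteFrith (PervinFrith.Omega.obj X).unop)
      (hpt : ∀ L : FrithFrame.{u}, CompleteFrith L → T0Complete (PervinFrith.pt.obj (op L))),
      (PervinFrith.restrictOmega hΩ).IsEquivalence ∧
      (PervinFrith.restrictPt hpt).IsEquivalence ∧
      IsIso (PervinFrith.restrictAdjunction hΩ hpt).unit ∧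
      IsIso (PervinFrith.restrictAdjunction hΩ hpt).counit ∧
      (∀ X : Pervin.{u}, T0Complete X → X.IsSober) ∧
      (∀ L : FrithFrame.{u}, CompleteFrith L → L.IsSpatial) := by
  have hL : ∀ L : FrithFrame.{u}, CompleteFrith L → L.IsCoherent := fun L h =>
    (FrithFrame.isComplete_iff_isCoherent pit).1 h
  have hΩ : ∀ X : Pervin.{u}, T0Complete X → CompleteFrith (PervinFrith.Omega.obj X).unop :=
    fun X hX => (FrithFrame.isComplete_iff_isCoherent pit).2
      (PervinFrith.isCoherent_opensFrith pit hX)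
  have hpt : ∀ L : FrithFrame.{u}, CompleteFrith L → T0Complete (PervinFrith.pt.obj (op L)) :=
    fun L h => ⟨PervinFrith.isT0_ptPervin L, PervinFrith.isComplete_ptPervin (hL L h)⟩
  have hunit : ∀ X, IsIso ((PervinFrith.restrictAdjunction hΩ hpt).unit.app X) := fun X => by
    -- Inclusions of full subcategories reflect isomorphisms, so only the underlying morphism has to
    -- be inverted.
    have : IsIso (T0Complete.ι.map ((PervinFrith.restrictAdjunction hΩ hpt).unit.app X)) :=
      PervinFrith.isIso_unitHom pit X.property
    exact isIso_of_reflects_iso _ T0Complete.ι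
  have hcounit : ∀ L, IsIso ((PervinFrith.restrictAdjunction hΩ hpt).counit.app L) := fun L => by
    have : IsIso (CompleteFrith.ι.map ((PervinFrith.restrictAdjunction hΩ hpt).counit.app L).unop) :=
      PervinFrith.isIso_counitHom pit (hL _ L.unop.property)
    have : IsIso ((PervinFrith.restrictAdjunction hΩ hpt).counit.app L).unop :=
      isIso_of_reflects_iso _ CompleteFrith.ι
    exact (isIso_unop_iff _).1 this
  exact ⟨hΩ, hpt, (PervinFrith.restrictAdjunction hΩ hpt).toEquivalence.isEquivalence_functor,
    (PervinFrith.restrictAdjunction hΩ hpt).toEquivalence.isEquivalence_inverse,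
    NatIso.isIso_of_isIso_app _, NatIso.isIso_of_isIso_app _,
    fun X hX => Pervin.isSober pit hX, fun L h => PervinFrith.isSpatial_of_isCoherent pit (hL L h)⟩
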